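/- The \emph{extension complexity} $\mathrm{xc}(P)$ of a polytope $P \subseteq \mathbb{R}^d$ is the minimum number of inequalities in a linear system $Ax + By \leqslant b,\ Cx + Dy = c$, with $x \in \mathbb{R}^d$, $y \in \mathbb{R}^m$ for some $m$, and any finite number of equations, such that $P = \{x \in \mathbb{R}^d \mid \exists y \in \mathbb{R}^m : Ax + By \leqslant b,\ Cx + Dy = c\}$. The \emph{spanning tree polytope} $\mathrm{STP}(G) \subseteq \mathbb{R}^E$ of a connected finite simple graph $G = (V,E)$ is the convex hull of the characteristic vectors of the edge sets of the spanning trees of $G$. For an integer $k \geqslant 1$, the graph $G$ is \emph{$k$-apex} if there is a set $X \subseteq V$ with $|X| \leqslant k$ such that $G - X$ is planar. Theorem. If $G = (V,E)$ is a connected $k$-apex graph, where $k \geqslant 1$, then $\mathrm{xc}(\mathrm{STP}(G)) = O(k \cdot |E|) = O(k^2 \cdot |V|)$. That is, there is an absolute constant $c$ such that, for all integers $k \geqslant 1$ and all connected $k$-apex graphs $G = (V,E)$, $$\mathrm{xc}(\mathrm{STP}(G)) \leqslant c \cdot k \cdot |E|, \qquad k \cdot |E| \leqslant c \cdot k^2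 \cdot |V|, \qquad \mathrm{xc}(\mathrm{STP}(G)) \leqslant c \cdot k^2 \cdot |V|.$$ -/

import Mathlib

/-- An extended formulation of `P` with `m` inequalities: a system `A x + B y ≤ b`, `C x + D y = c`
in the variables `x` and finitely many additional real variables `y`, with `m` inequalities and
any finite number of equations, whose solution set projects onto `P`. -/
def HasExtendedFormulation {E : Type*} [AddCommGroup E] [Module ℝ E] (P : Set E) (m : ℕ) : Prop :=
  ∃ (d p : ℕ)
    (A : E →ₗ[ℝ] (Fin m → ℝ)) (B : (Fin d → ℝ) →ₗ[ℝ] (Fin m → ℝ)) (b : Fin m → ℝ)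
    (C : E →ₗ[ℝ] (Fin p → ℝ)) (D : (Fin d → ℝ) →ₗ[ℝ] (Fin p → ℝ)) (c : Fin p → ℝ),
    P = {x : E | ∃ y : Fin d → ℝ, A x + B y ≤ b ∧ C x + D y = c}

/-- The extension complexity of `P`: the minimum number of inequalities of an extended
formulation of `P` (with value `⊤` if `P` has none, that is, if `P` is not a polyhedron). -/
noncomputable def extensionComplexity {E : Type*} [AddCommGroup E] [Module ℝ E]
    (P : Set E) : ℕ∞ :=
  ⨅ (m : ℕ) (_ : HasExtendedFormulation P m), (m : ℕ∞)

/-- The characteristic vector, in `ℝ^E` with `E` the edge set of `G`, of the edge set of `T`. -/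
noncomputable def edgeVector {V : Type*} (G T : SimpleGraph V) : G.edgeSet → ℝ :=
  fun e => Set.indicator T.edgeSet (fun _ => (1 : ℝ)) (e : Sym2 V)

/-- The spanning tree polytope of `G`: the convex hull in `ℝ^E` of the characteristic vectors of
the spanning trees of `G`, a spanning tree being a subgraph of `G` on all of `V` that is a tree. -/
def spanningTreePolytope {V : Type*} (G : SimpleGraph V) : Set (G.edgeSet → ℝ) :=
  convexHull ℝ {x | ∃ T : SimpleGraph V, T ≤ G ∧ T.IsTree ∧ x = edgeVector G T}

/-- A drawing of `G` in the plane without crossings: the vertices are distinct points, every edge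
is a simple arc joining its two ends, and the interior of an edge contains no vertex and
no point of any other edge. -/
structure PlaneDrawing {V : Type*} (G : SimpleGraph V) where
  /-- the point that represents a vertex -/
  point : V → EuclideanSpace ℝ (Fin 2)
  /-- the arc that represents an edge, traversed in one of its two directions -/
  arc : G.edgeSet → unitInterval → EuclideanSpace ℝ (Fin 2)
  point_injective : Function.Injective point
  arc_continuous : ∀ e, Continuous (arc e)
  arc_injective : ∀ e, Function.Injective (arc e)
  arc_ends : ∀ e, s(arc e 0, arc e 1) = Sym2.map point (e : Sym2 V)
  arc_ne_point : ∀ e, ∀ t ∈ Set.Ioo (0 : unitInterval) 1, ∀ v, arc e t ≠ point v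
  arc_ne_arc : ∀ e f, e ≠ f → ∀ s ∈ Set.Ioo (0 : unitInterval) 1,
    ∀ t ∈ Set.Ioo (0 : unitInterval) 1, arc e s ≠ arc f t

/-- A graph is planar if it can be drawn in the plane without crossings. -/
def IsPlanar {V : Type*} (G : SimpleGraph V) : Prop :=
  Nonempty (PlaneDrawing G)

/-- A graph is `k`-apex if there is a set `X` of at most `k` vertices such that the graph `G - X`
is planar. -/
def IsApex {V : Type*} (k : ℕ) (G : SimpleGraph V) : Prop :=
  ∃ X : Finset V, X.card ≤ k ∧ IsPlanar (G.induce {v | v ∉ X})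

/-!
Let `X` be a set of at most `k` vertices such that `G - X` is planar. By Edmonds' theorem
(`mem_spanningTreePolytope`) the spanning tree polytope consists of the `x ≥ 0` of total weight
`|V| - 1` that have weight at most `|U| - 1` inside every connected vertex set `U`. Such a set
contains a vertex of `X` or lies in a component of `G - X`, so the polytope is an intersection of
projections of small polyhedra, one for every vertex in `X` and one for every component of `G - X`.

For the sets that contain a fixed vertex `v`, Martin's formulation splits every `x e` among the two
ends of `e` so that every vertex other than `v` receives `1` and `v` receives `0`
(`exists_formulation_of_vertex`, with `2 |E|` inequalities). For a connected planar graph,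
Williams' formulation does the same for a tree with a root vertex and, simultaneously, for the
complementary edges, which form a tree of the dual graph, with a root face
(`IsPlanar.exists_formulation`, with five inequalities per edge). That this implies all the
inequalities is `DualGraph.sum_inside_le`, a count by Euler's formula. Altogether `(6 + 2 k) |E|`
inequalities suffice, and `|E| ≤ (3 + k) |V|` because a planar graph has at most `3 |V|` edges.

The dual graph is the topological part. Only its algebraic form is needed (`DualGraph`): the cycle
space over `ℚ` of the drawn graph consists of the coboundaries of functions on the faces, and the
edges at a vertex join the faces around it. The potential of a cycle is its winding number around
points of the faces. Winding numbers are defined through continuous logarithms along the edges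
(`ArcSystem.wind`); that they can be prescribed on the bounded faces follows from Eilenberg's
criterion for the existence of logarithms (`no_log_on_frontier`), and that an edge on a cycle has
different faces on its two sides from a weak form of the Jordan curve theorem
(`not_isPreconnected_compl_union`). The rest is linear algebra: Euler's formula
(`DualGraph.card_le_of_region`) counts dimensions, and the assignment of the edges of a tree to its
vertices is Hall's theorem (`exists_tree_orientation`).
-/

section Topology

open scoped unitInterval

/-! ### Logarithms in the plane -/

/-- Homotopy lifting through the exponential: a nonvanishing `H` has a continuous logarithm that
extends a given logarithm at time `0`. -/
theorem exists_log_homotopy {A : Type*} [TopologicalSpace A] {H : I × A → ℂ} (hH : Continuous H)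
    (h0 : ∀ x, H x ≠ 0) {g : A → ℂ} (hg : Continuous g) (hg0 : ∀ a, Complex.exp (g a) = H (0, a)) :
    ∃ L : I × A → ℂ, Continuous L ∧ (∀ x, Complex.exp (L x) = H x) ∧ ∀ a, L (0, a) = g a := by
  have cov := Complex.isCoveringMap_exp
  let H' : C(I × A, {z : ℂ // z ≠ 0}) := ⟨fun x => ⟨H x, h0 x⟩, by fun_prop⟩
  have hH0 : ∀ a, H' (0, a) =
      (⟨_, Complex.exp_ne_zero ((⟨g, hg⟩ : C(A, ℂ)) a)⟩ : {z : ℂ // z ≠ 0}) := by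
    intro a
    exact Subtype.ext (hg0 a).symm
  refine ⟨cov.liftHomotopy H' ⟨g, hg⟩ hH0, (cov.liftHomotopy H' ⟨g, hg⟩ hH0).continuous, ?_, ?_⟩
  · intro x
    exact congrArg Subtype.val (congrFun (cov.liftHomotopy_lifts H' ⟨g, hg⟩ hH0) x)
  · intro a
    exact cov.liftHomotopy_zero H' ⟨g, hg⟩ hH0 a

theorem exists_log_path {γ : I → ℂ} (hγ : Continuous γ) (h0 : ∀ t, γ t ≠ 0) {w : ℂ}
    (hw : Complex.exp w = γ 0) :
    ∃ L : I → ℂ, Continuous L ∧ (∀ t, Complex.exp (L t) = γ t) ∧ L 0 = w := by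
  obtain ⟨L, hL, hL1, hL2⟩ := exists_log_homotopy (A := Unit) (H := fun x => γ x.1)
    (by fun_prop) (fun x => h0 _) (g := fun _ => w) continuous_const (fun _ => hw)
  exact ⟨fun t => L (t, ()), by fun_prop, fun t => hL1 _, hL2 ()⟩

theorem exists_log_plane {f : ℂ → ℂ} (hf : Continuous f) (h0 : ∀ z, f z ≠ 0) :
    ∃ L : ℂ → ℂ, Continuous L ∧ ∀ z, Complex.exp (L z) = f z := by
  obtain ⟨L, hL, hL1, hL2⟩ := exists_log_homotopy (A := ℂ)
    (H := fun x => f (((x.1 : ℝ) : ℂ) * x.2)) (by fun_prop) (fun x => h0 _)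
    (g := fun _ => Complex.log (f 0)) continuous_const (fun a => by simp [Complex.exp_log (h0 0)])
  exact ⟨fun z => L (1, z), by fun_prop, fun z => by simp [hL1]⟩

/-- Two continuous logarithms of the same function differ by a constant on a preconnected set. -/
theorem log_sub_log_const {X : Type*} [TopologicalSpace X] {s : Set X} (hs : IsPreconnected s)
    {L M : X → ℂ} (hL : ContinuousOn L s) (hM : ContinuousOn M s)
    (h : ∀ x ∈ s, Complex.exp (L x) = Complex.exp (M x)) {x y : X} (hx : x ∈ s) (hy : y ∈ s) :
    L x - M x = L y - M y := by
  have hk : ∀ x ∈ s, ∃ n : ℤ, L x - M x = n * (2 * Real.pi * Complex.I) := by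
    intro x hx
    obtain ⟨n, hn⟩ := Complex.exp_eq_exp_iff_exists_int.1 (h x hx)
    exact ⟨n, by rw [hn]; ring⟩
  have hc : ContinuousOn (fun x => (L x - M x).im / (2 * Real.pi)) s := by
    have := hL.sub hM
    fun_prop
  have hpi : (2 * Real.pi) ≠ 0 := by positivity
  have hint : ∀ x ∈ s, ∃ n : ℤ, (L x - M x).im / (2 * Real.pi) = n ∧
      L x - M x = n * (2 * Real.pi * Complex.I) := by
    intro x hx
    obtain ⟨n, hn⟩ := hk x hx
    refine ⟨n, ?_, hn⟩
    rw [hn]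
    simp
  -- an integer-valued continuous function on a preconnected set is constant
  have himg : IsPreconnected ((fun x => (L x - M x).im / (2 * Real.pi)) '' s) := hs.image _ hc
  have hord := himg.ordConnected
  obtain ⟨n, hn1, hn2⟩ := hint x hx
  obtain ⟨m, hm1, hm2⟩ := hint y hy
  rcases lt_trichotomy n m with hlt | heq | hlt
  · have hmem : ((n : ℝ) + 1 / 2) ∈ (fun x => (L x - M x).im / (2 * Real.pi)) '' s := by
      refine hord.out ⟨x, hx, hn1⟩ ⟨y, hy, hm1⟩ ⟨by linarith, ?_⟩
      have : (n : ℝ) + 1 ≤ m := by exact_mod_cast hlt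
      linarith
    obtain ⟨u, hu, hue⟩ := hmem
    obtain ⟨k, hk1, -⟩ := hint u hu
    have : (k : ℝ) = n + 1 / 2 := by rw [← hk1]; exact hue
    have h2 : (2 * k : ℝ) = 2 * n + 1 := by linarith
    have h3 : 2 * k = 2 * n + 1 := by exact_mod_cast h2
    omega
  · rw [hn2, hm2, heq]
  · have hmem : ((m : ℝ) + 1 / 2) ∈ (fun x => (L x - M x).im / (2 * Real.pi)) '' s := by
      refine hord.out ⟨y, hy, hm1⟩ ⟨x, hx, hn1⟩ ⟨by linarith, ?_⟩
      have : (m : ℝ) + 1 ≤ n := by exact_mod_cast hlt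
      linarith
    obtain ⟨u, hu, hue⟩ := hmem
    obtain ⟨k, hk1, -⟩ := hint u hu
    have : (k : ℝ) = m + 1 / 2 := by rw [← hk1]; exact hue
    have h2 : (2 * k : ℝ) = 2 * m + 1 := by linarith
    have h3 : 2 * k = 2 * m + 1 := by exact_mod_cast h2
    omega

/-- A nonzero power of `z - c` has no continuous logarithm on a circle around `c`. -/
theorem no_log_zpow_on_circle {c : ℂ} {R : ℝ} (hR : 0 < R) {k : ℤ} (hk : k ≠ 0) {h : ℂ → ℂ}
    (hc : ContinuousOn h (Metric.sphere c R))
    (he : ∀ z ∈ Metric.sphere c R, Complex.exp (h z) = (z - c) ^ k) : False := by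
  have hRC : (R : ℂ) ≠ 0 := by exact_mod_cast hR.ne'
  let γ : ℝ → ℂ := fun θ => c + R * Complex.exp (θ * Complex.I)
  have hγ : Continuous γ := by fun_prop
  have hmem : ∀ θ, γ θ ∈ Metric.sphere c R := by
    intro θ
    simp [γ, Complex.norm_exp_ofReal_mul_I, abs_of_pos hR]
  let M : ℝ → ℂ := fun θ => k * (Real.log R + θ * Complex.I)
  have hM : Continuous M := by fun_prop
  have key := log_sub_log_const (X := ℝ) isPreconnected_univ (L := fun θ => h (γ θ)) (M := M)
    ((hc.comp_continuous hγ hmem).continuousOn) hM.continuousOn (by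
      intro θ _
      rw [he _ (hmem θ), Complex.exp_int_mul, Complex.exp_add, ← Complex.ofReal_exp,
        Real.exp_log hR]
      simp [γ]) (Set.mem_univ 0) (Set.mem_univ (2 * Real.pi))
  have hper : γ (2 * Real.pi) = γ 0 := by
    simp [γ, Complex.exp_two_pi_mul_I]
  simp only [hper, M] at key
  have h3 : (k : ℂ) * (2 * Real.pi * Complex.I) = 0 := by
    push_cast at key
    linear_combination key
  have : (k : ℂ) ≠ 0 := by exact_mod_cast hk
  simp [this, Real.pi_ne_zero] at h3

/-- Eilenberg's criterion: if `p` lies in a bounded open set `U` with frontier in the closed set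
`K`, then no product of a nonzero power of `z - p` with a function `Q` that is continuous and
nonvanishing on `closure U` has a continuous logarithm on `K`. Otherwise extend the logarithm to
the plane by Tietze's theorem; its exponential divided by `Q` inside `U` and `(z - p) ^ k` outside
glue to a nonvanishing function on the plane, which has a logarithm, and this is absurd on a large
circle. -/
theorem no_log_on_frontier {U K : Set ℂ} (hUo : IsOpen U) (hUb : Bornology.IsBounded U)
    (hK : IsClosed K) (hUK : frontier U ⊆ K) {p : ℂ} (hp : p ∈ U) {k : ℤ} (hk : k ≠ 0)
    {Q : ℂ → ℂ} (hQ : ContinuousOn Q (closure U)) (hQ0 : ∀ z ∈ closure U, Q z ≠ 0)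
    {g : ℂ → ℂ} (hg : ContinuousOn g K)
    (he : ∀ z ∈ K, Complex.exp (g z) = (z - p) ^ k * Q z) : False := by
  classical
  obtain ⟨G, hG⟩ := ContinuousMap.exists_restrict_eq (Y := ℂ) hK
    ⟨K.domRestrict g, continuousOn_iff_continuous_domRestrict.1 hg⟩
  have hGK : ∀ z ∈ K, G z = g z := by
    intro z hz
    exact congrArg (fun f => f ⟨z, hz⟩) hG
  -- the two definitions agree on the frontier of `U`, where `G` is the given logarithm
  let f : ℂ → ℂ := fun z => if z ∈ closure U then Complex.exp (G z) / Q z else (z - p) ^ k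
  have hfr : frontier (closure U) ⊆ frontier U := frontier_closure_subset
  have hpc : ∀ z ∉ U, z - p ≠ 0 := by
    intro z hz h
    apply hz
    rwa [sub_eq_zero.1 h]
  have hf : Continuous f := by
    refine continuous_if ?_ ?_ ?_
    · intro z hz
      have hzU := hfr hz
      have hzc : z ∈ closure U := frontier_subset_closure hzU
      change Complex.exp (G z) / Q z = _
      rw [hGK z (hUK hzU), he z (hUK hzU), mul_div_assoc, div_self (hQ0 z hzc), mul_one]
    · have : closure {x | x ∈ closure U} = closure U := isClosed_closure.closure_eq
      rw [this]
      refine ContinuousOn.div (by fun_prop) hQ hQ0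
    · refine ContinuousOn.zpow₀ (by fun_prop) k ?_
      intro z hz
      left
      apply hpc
      intro hzU
      have h1 : closure {x | x ∉ closure U} ⊆ Uᶜ := by
        refine closure_minimal ?_ hUo.isClosed_compl
        intro x hx hxU
        exact hx (subset_closure hxU)
      exact h1 hz hzU
  have hf0 : ∀ z, f z ≠ 0 := by
    intro z
    by_cases hz : z ∈ closure U
    · simp only [f, hz, if_true]
      exact div_ne_zero (Complex.exp_ne_zero _) (hQ0 z hz)
    · simp only [f, hz, if_false]
      exact zpow_ne_zero _ (hpc z fun h => hz (subset_closure h))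
  obtain ⟨L, hL, hLe⟩ := exists_log_plane hf hf0
  obtain ⟨R, hR⟩ := hUb.closure.subset_ball p
  have hR0 : 0 < R := Metric.pos_of_mem_ball (hR (subset_closure hp))
  refine no_log_zpow_on_circle hR0 hk (c := p) (h := L) hL.continuousOn ?_
  intro z hz
  rw [hLe]
  have : z ∉ closure U := by
    intro h
    have := hR h
    simp only [Metric.mem_ball, Metric.mem_sphere] at this hz
    linarith
  simp [f, this]

/-! ### Separation of the plane -/

/-- Off a path from `a` to `b` the function `(z - b) / (z - a)` has a continuous logarithm,
obtained by moving the point `b` to `a` along the path. -/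
theorem exists_log_div_off_path {α : I → ℂ} (hα : Continuous α) :
    ∃ M : ℂ → ℂ, ContinuousOn M (Set.range α)ᶜ ∧
      ∀ z ∈ (Set.range α)ᶜ, Complex.exp (M z) = (z - α 1) / (z - α 0) := by
  classical
  have hne : ∀ z : ((Set.range α)ᶜ : Set ℂ), ∀ t, (z : ℂ) - α t ≠ 0 := by
    intro z t h
    exact z.2 ⟨t, (sub_eq_zero.1 h).symm⟩
  obtain ⟨L, hL, hL1, -⟩ := exists_log_homotopy (A := ((Set.range α)ᶜ : Set ℂ))
    (H := fun x => ((x.2 : ℂ) - α x.1) / ((x.2 : ℂ) - α 0))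
    (Continuous.div (by fun_prop) (by fun_prop) (fun x => hne x.2 0))
    (fun x => div_ne_zero (hne x.2 _) (hne x.2 _)) (g := fun _ => 0) continuous_const
    (fun z => by simp [div_self (hne z 0)])
  refine ⟨fun z => if hz : z ∈ (Set.range α)ᶜ then L (1, ⟨z, hz⟩) else 0, ?_, ?_⟩
  · rw [continuousOn_iff_continuous_domRestrict]
    have : Continuous fun z : ((Set.range α)ᶜ : Set ℂ) => L (1, z) := by fun_prop
    refine this.congr ?_
    intro z
    have hz := z.2
    simp only [Set.domRestrict_apply, hz, dite_true]
  · intro z hz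
    simp only [hz, dite_true, hL1]

/-- Two compact sets that meet only in `a ≠ b` and in each of which `a` and `b` can be joined
separate the plane: otherwise the logarithms of `(z - b) / (z - a)` off the two sets could be
chosen to agree where both are defined, and together they would give a logarithm off `{a, b}`. -/
theorem not_isPreconnected_compl_union {K₁ K₂ : Set ℂ} (hK₁ : IsCompact K₁) (hK₂ : IsCompact K₂)
    {a b : ℂ} (hab : a ≠ b) (h₁ : JoinedIn K₁ a b) (h₂ : JoinedIn K₂ a b)
    (hint : K₁ ∩ K₂ ⊆ {a, b}) : ¬ IsPreconnected ((K₁ ∪ K₂)ᶜ : Set ℂ) := by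
  classical
  intro hpre
  have hlog : ∀ K : Set ℂ, JoinedIn K a b → ∃ M : ℂ → ℂ, ContinuousOn M Kᶜ ∧
      ∀ z ∈ Kᶜ, Complex.exp (M z) = (z - b) / (z - a) := by
    intro K hK
    have hsub : Kᶜ ⊆ (Set.range hK.somePath)ᶜ := by
      rw [Set.compl_subset_compl]
      rintro _ ⟨t, rfl⟩
      exact hK.somePath_mem t
    obtain ⟨M, hM, hMe⟩ := exists_log_div_off_path hK.somePath.continuous
    exact ⟨M, hM.mono hsub, fun z hz => by rw [hMe z (hsub hz)]; simp⟩
  obtain ⟨M, hM, hMe⟩ := hlog K₁ h₁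
  obtain ⟨N, hN, hNe⟩ := hlog K₂ h₂
  have hαc : IsClosed K₁ := hK₁.isClosed
  have hβc : IsClosed K₂ := hK₂.isClosed
  obtain ⟨m, hm⟩ : ∃ m : ℂ, ∀ z ∈ ((K₁ ∪ K₂)ᶜ : Set ℂ), M z = N z + m := by
    by_cases hne : ((K₁ ∪ K₂)ᶜ : Set ℂ).Nonempty
    · obtain ⟨y, hy⟩ := hne
      refine ⟨M y - N y, fun z hz => ?_⟩
      have := log_sub_log_const hpre (hM.mono (by intro x hx h; exact hx (Or.inl h)))
        (hN.mono (by intro x hx h; exact hx (Or.inr h))) (by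
          intro x hx
          rw [hMe x fun h => hx (Or.inl h), hNe x fun h => hx (Or.inr h)])
        hz hy
      linear_combination this
    · exact ⟨0, fun z hz => absurd ⟨z, hz⟩ hne⟩
  have hm1 : Complex.exp m = 1 ∨ ((K₁ ∪ K₂)ᶜ : Set ℂ) = ∅ := by
    rcases ((K₁ ∪ K₂)ᶜ : Set ℂ).eq_empty_or_nonempty with h | ⟨y, hy⟩
    · exact Or.inr h
    · left
      have h1 := hMe y fun h => hy (Or.inl h)
      rw [hm y hy, Complex.exp_add, hNe y fun h => hy (Or.inr h)] at h1
      have h2 : (y - b) / (y - a) ≠ 0 := by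
        apply div_ne_zero
        · intro h
          exact hy (Or.inl (sub_eq_zero.1 h ▸ h₁.target_mem))
        · intro h
          exact hy (Or.inl (sub_eq_zero.1 h ▸ h₁.source_mem))
      exact mul_left_cancel₀ h2 (by rw [h1, mul_one])
  -- the union is bounded, so its complement is nonempty
  have hm1 : Complex.exp m = 1 := by
    rcases hm1 with h | h
    · exact h
    · exfalso
      have hb : Bornology.IsBounded (K₁ ∪ K₂) :=
        (hK₁.union hK₂).isBounded
      rw [Set.compl_empty_iff] at h
      rw [h] at hb
      exact NormedSpace.unbounded_univ ℂ ℂ hb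
  let Λ : ℂ → ℂ := fun z => if z ∈ K₁ then N z + m else M z
  have hΛβ : ∀ z ∉ K₂, Λ z = N z + m := by
    intro z hz
    by_cases h : z ∈ K₁
    · simp only [Λ, h, if_true]
    · simp only [Λ, h, if_false]
      exact hm z (by simp only [Set.mem_compl_iff, Set.mem_union]; tauto)
  have hΛα : ∀ z ∉ K₁, Λ z = M z := by
    intro z hz
    simp only [Λ, hz, if_false]
  have hcov : ∀ z : ℂ, z ≠ a → z ≠ b → z ∉ K₁ ∨ z ∉ K₂ := by
    intro z ha hb
    by_contra! h
    have := hint h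
    simp only [Set.mem_insert_iff, Set.mem_singleton_iff] at this
    tauto
  have hΛc : ∀ z : ℂ, z ≠ a → z ≠ b → ContinuousAt Λ z := by
    intro z ha hb
    rcases hcov z ha hb with h | h
    · refine (hM.continuousAt (hαc.isOpen_compl.mem_nhds h)).congr ?_
      filter_upwards [hαc.isOpen_compl.mem_nhds h] with w hw
      exact (hΛα w hw).symm
    · refine ((hN.continuousAt (hβc.isOpen_compl.mem_nhds h)).add
        (continuousAt_const (y := m))).congr ?_
      filter_upwards [hβc.isOpen_compl.mem_nhds h] with w hw
      exact (hΛβ w hw).symm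
  have hΛe : ∀ z : ℂ, z ≠ a → z ≠ b → Complex.exp (Λ z) = (z - b) / (z - a) := by
    intro z ha hb
    rcases hcov z ha hb with h | h
    · rw [hΛα z h, hMe z h]
    · rw [hΛβ z h, Complex.exp_add, hm1, hNe z h, mul_one]
  have hd : 0 < ‖a - b‖ := norm_pos_iff.2 (sub_ne_zero.2 hab)
  have hsph : ∀ z ∈ Metric.sphere a (‖a - b‖ / 2), z ≠ a ∧ z ≠ b ∧
      (z - b) / (a - b) ∈ Complex.slitPlane := by
    intro z hz
    have hz' : ‖z - a‖ = ‖a - b‖ / 2 := by simpa [dist_eq_norm] using hz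
    refine ⟨?_, ?_, ?_⟩
    · rintro rfl
      simp at hz'
      linarith
    · rintro rfl
      rw [← norm_neg, neg_sub] at hz'
      linarith
    · have : (z - b) / (a - b) = 1 + (z - a) / (a - b) := by
        field_simp [sub_ne_zero.2 hab]
        ring
      rw [this]
      apply Complex.mem_slitPlane_of_norm_lt_one
      rw [norm_div, hz']
      rw [div_lt_one hd]
      linarith
  -- on a small circle around `a` both `(z - b) / (z - a)` and `z - b` have logarithms
  refine no_log_zpow_on_circle (c := a) (R := ‖a - b‖ / 2) (by positivity) (k := -1) (by norm_num)
    (h := fun z => Λ z - Complex.log ((z - b) / (a - b)) - Complex.log (a - b)) ?_ ?_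
  · refine ContinuousOn.sub (ContinuousOn.sub ?_ ?_) continuousOn_const
    · intro z hz
      exact (hΛc z (hsph z hz).1 (hsph z hz).2.1).continuousWithinAt
    · refine ContinuousOn.clog (by fun_prop) ?_
      intro z hz
      exact (hsph z hz).2.2
  · intro z hz
    obtain ⟨h1, h2, h3⟩ := hsph z hz
    have hza : z - a ≠ 0 := sub_ne_zero.2 h1
    have hzb : z - b ≠ 0 := sub_ne_zero.2 h2
    have hab' : a - b ≠ 0 := sub_ne_zero.2 hab
    rw [Complex.exp_sub, Complex.exp_sub, hΛe z h1 h2, Complex.exp_log (div_ne_zero hzb hab'),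
      Complex.exp_log hab']
    rw [zpow_neg_one]
    field_simp

/-! ### Cycles of a multigraph -/

theorem LinearMap.apply_eq_sum_single {ι R : Type*} [Fintype ι] [DecidableEq ι] [CommSemiring R]
    (f : (ι → R) →ₗ[R] R) (x : ι → R) : f x = ∑ i, f (Pi.single i 1) * x i := by
  rw [f.pi_apply_eq_sum_univ x]
  refine Finset.sum_congr rfl fun i _ => ?_
  rw [smul_eq_mul, mul_comm]
  congr 2
  ext j
  simp [Pi.single_apply, eq_comm]

/-- The rational cycle space of the multigraph with edges `e` from `src e` to `tgt e`: the
vectors orthogonal to all coboundaries `e ↦ g (tgt e) - g (src e)`. This is equivalent to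
conservation of flow at every vertex. -/
def cycleSpace {V E : Type*} [Fintype E] (src tgt : E → V) : Submodule ℚ (E → ℚ) where
  carrier := {z | ∀ g : V → ℚ, ∑ e, z e * (g (tgt e) - g (src e)) = 0}
  zero_mem' := by intro g; simp
  add_mem' := by
    intro x y hx hy g
    simp only [Pi.add_apply, add_mul, Finset.sum_add_distrib, hx g, hy g, add_zero]
  smul_mem' := by
    intro c x hx g
    simp only [Pi.smul_apply, smul_eq_mul, mul_assoc, ← Finset.mul_sum, hx g, mul_zero]

section
variable {V E : Type*} [Fintype E] {src tgt : E → V}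

theorem cycleSpace_sum_complex [Finite V] {z : E → ℚ} (hz : z ∈ cycleSpace src tgt) (g : V → ℂ) :
    ∑ e, (z e : ℂ) * (g (tgt e) - g (src e)) = 0 := by
  classical
  have := Fintype.ofFinite V
  have h1 : ∀ e, g (tgt e) - g (src e) =
      ∑ v, (((if tgt e = v then 1 else 0) - (if src e = v then 1 else 0) : ℚ) : ℂ) * g v := by
    intro e
    push_cast
    simp [sub_mul, Finset.sum_sub_distrib, apply_ite (Rat.cast : ℚ → ℂ)]
  simp_rw [h1, Finset.mul_sum]
  rw [Finset.sum_comm]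
  refine Finset.sum_eq_zero fun v _ => ?_
  have h2 := hz (fun w => if w = v then 1 else 0)
  have h3 : ((∑ e, z e * ((if tgt e = v then 1 else 0) - (if src e = v then 1 else 0)) : ℚ) : ℂ) =
      0 := by
    rw [h2]; simp
  push_cast at h3 ⊢
  rw [← zero_mul (g v), ← h3, Finset.sum_mul]
  refine Finset.sum_congr rfl fun e _ => by ring

/-- The cycles whose support is contained in `A`. -/
def cyclesIn {V E : Type*} [Fintype E] (src tgt : E → V) (A : Set E) : Submodule ℚ (E → ℚ) :=
  cycleSpace src tgt ⊓
    { carrier := {z | ∀ e ∉ A, z e = 0}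
      zero_mem' := by intro e _; rfl
      add_mem' := by
        intro x y hx hy e he
        simp [hx e he, hy e he]
      smul_mem' := by
        intro c x hx e he
        simp [hx e he] }

theorem mem_cyclesIn {A : Set E} {z : E → ℚ} :
    z ∈ cyclesIn src tgt A ↔ z ∈ cycleSpace src tgt ∧ ∀ e ∉ A, z e = 0 := Iff.rfl

/-- A cochain that is orthogonal to every cycle in `A` is a coboundary on `A`. -/
theorem exists_potential {A : Set E} {N : E → ℚ}
    (hN : ∀ z ∈ cyclesIn src tgt A, ∑ e, z e * N e = 0) :
    ∃ g : V → ℚ, ∀ e ∈ A, N e = g (tgt e) - g (src e) := by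
  classical
  let C : Submodule ℚ (E → ℚ) :=
    { carrier := {y | ∃ g : V → ℚ, ∀ e ∈ A, y e = g (tgt e) - g (src e)}
      zero_mem' := ⟨0, by simp⟩
      add_mem' := by
        rintro x y ⟨g, hg⟩ ⟨h, hh⟩
        refine ⟨g + h, fun e he => ?_⟩
        simp only [Pi.add_apply, hg e he, hh e he]
        ring
      smul_mem' := by
        rintro c x ⟨g, hg⟩
        refine ⟨c • g, fun e he => ?_⟩
        simp only [Pi.smul_apply, smul_eq_mul, hg e he]
        ring }
  by_contra hcon
  have hNC : N ∉ C := hcon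
  obtain ⟨f, hf, hCf⟩ := Submodule.exists_le_ker_of_notMem hNC
  let z : E → ℚ := fun e => f (Pi.single e 1)
  have hfz : ∀ y, f y = ∑ e, z e * y e := f.apply_eq_sum_single
  apply hf
  rw [hfz]
  apply hN
  constructor
  · intro g
    have : (fun e => g (tgt e) - g (src e)) ∈ C := ⟨g, fun e _ => rfl⟩
    have := hCf this
    rwa [LinearMap.mem_ker, hfz] at this
  · intro e he
    have : (Pi.single e 1 : E → ℚ) ∈ C := by
      refine ⟨0, fun e' he' => ?_⟩
      have : e' ≠ e := by rintro rfl; exact he he'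
      simp [this]
    exact hCf this

/-- Two vertices are joined by a path of edges in `A`, traversed in either direction. Every vertex
is joined to itself. -/
def JoinedBy (src tgt : E → V) (A : Set E) : V → V → Prop :=
  Relation.EqvGen fun u v => ∃ e ∈ A, src e = u ∧ tgt e = v

omit [Fintype E] in
theorem JoinedBy.apply_eq {A : Set E} {α : Type*} {g : V → α}
    (hg : ∀ e ∈ A, g (src e) = g (tgt e)) {u v : V} (h : JoinedBy src tgt A u v) : g u = g v := by
  induction h with
  | rel x y h =>
    obtain ⟨e, he, rfl, rfl⟩ := h
    exact hg e he
  | refl x => rfl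
  | symm x y _ ih => exact ih.symm
  | trans x y z _ _ ih1 ih2 => exact ih1.trans ih2

/-- The ends of an edge of a cycle are joined by the other edges of that cycle. -/
theorem joinedBy_of_mem_cyclesIn {A : Set E} {z : E → ℚ} (hz : z ∈ cyclesIn src tgt A) {e : E}
    (he : z e ≠ 0) : JoinedBy src tgt (A \ {e}) (src e) (tgt e) := by
  classical
  by_contra hcon
  let g : V → ℚ := fun v => if JoinedBy src tgt (A \ {e}) (src e) v then 1 else 0
  have h1 := hz.1 g
  rw [Finset.sum_eq_single e] at h1
  · have h2 : JoinedBy src tgt (A \ {e}) (src e) (src e) := Relation.EqvGen.refl _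
    simp only [g, hcon, h2, if_true, if_false] at h1
    simp [he] at h1
  · intro f _ hfe
    by_cases hfA : f ∈ A
    · have h2 : JoinedBy src tgt (A \ {e}) (src e) (src f) ↔
          JoinedBy src tgt (A \ {e}) (src e) (tgt f) := by
        have h3 : JoinedBy src tgt (A \ {e}) (src f) (tgt f) :=
          Relation.EqvGen.rel _ _ ⟨f, ⟨hfA, hfe⟩, rfl, rfl⟩
        exact ⟨fun h => h.trans _ _ _ h3, fun h => h.trans _ _ _ (h3.symm _ _)⟩
      simp only [g, h2, sub_self, mul_zero]
    · rw [hz.2 f hfA, zero_mul]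
  · simp

/-- Joined vertices are joined by a set of edges that contains no cycle. -/
theorem exists_acyclic_joinedBy {A : Set E} {u v : V} (h : JoinedBy src tgt A u v) :
    ∃ B ⊆ A, JoinedBy src tgt B u v ∧ ∀ z ∈ cyclesIn src tgt B, z = 0 := by
  -- a minimal joining set: an edge of a cycle in it could be bypassed, hence deleted
  have hfin : {B : Set E | B ⊆ A ∧ JoinedBy src tgt B u v}.Finite := Set.toFinite _
  obtain ⟨B, hB⟩ := hfin.exists_minimal ⟨A, subset_rfl, h⟩
  refine ⟨B, hB.prop.1, hB.prop.2, fun z hz => ?_⟩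
  by_contra hne
  obtain ⟨e, he⟩ := Function.ne_iff.1 hne
  have heB : e ∈ B := by
    by_contra h'
    exact he (hz.2 e h')
  have h1 := joinedBy_of_mem_cyclesIn hz he
  have h2 : JoinedBy src tgt (B \ {e}) u v := by
    have : ∀ {x y}, JoinedBy src tgt B x y → JoinedBy src tgt (B \ {e}) x y := by
      intro x y hxy
      induction hxy with
      | rel x y h =>
        obtain ⟨f, hf, rfl, rfl⟩ := h
        by_cases hfe : f = e
        · rw [hfe]; exact h1
        · exact Relation.EqvGen.rel _ _ ⟨f, ⟨hf, hfe⟩, rfl, rfl⟩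
      | refl x => exact Relation.EqvGen.refl _
      | symm x y _ ih => exact ih.symm _ _
      | trans x y z _ _ ih1 ih2 => exact ih1.trans _ _ _ ih2
    exact this hB.prop.2
  have h3 := hB.le_of_le (y := B \ {e}) ⟨Set.sdiff_subset.trans hB.prop.1, h2⟩ Set.sdiff_subset
  exact (h3 heB).2 rfl

end

/-! ### Winding numbers of cycles in a drawing -/

/-- A crossing-free drawing in `ℂ` of a multigraph without loops, with an orientation of the edges:
the edge `e` is drawn as the simple arc `arc e` from `pt (src e)` to `pt (tgt e)`. Parallel edges
are allowed. -/
structure ArcSystem (V E : Type*) where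
  /-- the initial vertex of an edge -/
  src : E → V
  /-- the final vertex of an edge -/
  tgt : E → V
  /-- the point that represents a vertex -/
  pt : V → ℂ
  /-- the arc that represents an edge -/
  arc : E → I → ℂ
  pt_injective : Function.Injective pt
  arc_continuous : ∀ e, Continuous (arc e)
  arc_injective : ∀ e, Function.Injective (arc e)
  arc_zero : ∀ e, arc e 0 = pt (src e)
  arc_one : ∀ e, arc e 1 = pt (tgt e)
  arc_ne_pt : ∀ e, ∀ t ∈ Set.Ioo (0 : I) 1, ∀ v, arc e t ≠ pt v
  arc_ne_arc : ∀ e f, e ≠ f → ∀ s ∈ Set.Ioo (0 : I) 1, ∀ t ∈ Set.Ioo (0 : I) 1, arc e s ≠ arc f t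

theorem unitInterval.eq_zero_or_one_or_mem_Ioo (t : I) : t = 0 ∨ t = 1 ∨ t ∈ Set.Ioo (0 : I) 1 := by
  rcases (bot_le : (0 : I) ≤ t).eq_or_lt with h | h
  · exact Or.inl h.symm
  · rcases (le_top : t ≤ 1).eq_or_lt with h' | h'
    · exact Or.inr (Or.inl h')
    · exact Or.inr (Or.inr ⟨h, h'⟩)

namespace ArcSystem

variable {V E : Type*} (D : ArcSystem V E)

/-- The part of the plane covered by the edges in `A`. -/
def body (A : Set E) : Set ℂ := ⋃ e ∈ A, Set.range (D.arc e)

theorem body_mono {A B : Set E} (h : A ⊆ B) : D.body A ⊆ D.body B :=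
  Set.biUnion_subset_biUnion_left h

theorem arc_mem_body {A : Set E} {e : E} (he : e ∈ A) (t : I) : D.arc e t ∈ D.body A :=
  Set.mem_biUnion he ⟨t, rfl⟩

theorem mem_body {A : Set E} {x : ℂ} : x ∈ D.body A ↔ ∃ e ∈ A, ∃ t, D.arc e t = x := by
  simp [body]

theorem isCompact_body [Finite E] (A : Set E) : IsCompact (D.body A) :=
  (Set.toFinite A).isCompact_biUnion fun e _ => isCompact_range (D.arc_continuous e)

theorem isOpen_compl_body [Finite E] (A : Set E) : IsOpen (D.body A)ᶜ :=
  (D.isCompact_body A).isClosed.isOpen_compl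

/-- Two edges share only end points. -/
theorem arc_eq_arc {e f : E} {s t : I} (h : D.arc e s = D.arc f t) :
    (e = f ∧ s = t) ∨ ((s = 0 ∨ s = 1) ∧ (t = 0 ∨ t = 1)) := by
  by_cases hef : e = f
  · subst hef
    exact Or.inl ⟨rfl, D.arc_injective e h⟩
  right
  rcases unitInterval.eq_zero_or_one_or_mem_Ioo s with hs | hs | hs <;>
  rcases unitInterval.eq_zero_or_one_or_mem_Ioo t with ht | ht | ht
  · exact ⟨Or.inl hs, Or.inl ht⟩
  · exact ⟨Or.inl hs, Or.inr ht⟩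
  · rw [hs, D.arc_zero] at h
    exact absurd h.symm (D.arc_ne_pt f t ht _)
  · exact ⟨Or.inr hs, Or.inl ht⟩
  · exact ⟨Or.inr hs, Or.inr ht⟩
  · rw [hs, D.arc_one] at h
    exact absurd h.symm (D.arc_ne_pt f t ht _)
  · rw [ht, D.arc_zero] at h
    exact absurd h (D.arc_ne_pt e s hs _)
  · rw [ht, D.arc_one] at h
    exact absurd h (D.arc_ne_pt e s hs _)
  · exact absurd h (D.arc_ne_arc e f hef s hs t ht)

theorem exists_turns (p : ℂ) (e : E) (h : p ∉ Set.range (D.arc e)) :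
    ∃ n : ℤ, ∃ L : I → ℂ, Continuous L ∧ (∀ t, Complex.exp (L t) = D.arc e t - p) ∧
      L 0 = Complex.log (D.pt (D.src e) - p) ∧
      L 1 = Complex.log (D.pt (D.tgt e) - p) + 2 * Real.pi * Complex.I * n := by
  have hne : ∀ t, D.arc e t - p ≠ 0 := fun t ht => h ⟨t, sub_eq_zero.1 ht⟩
  have h0 := hne 0
  have h1 := hne 1
  rw [D.arc_zero] at h0
  rw [D.arc_one] at h1
  obtain ⟨L, hL, hLe, hL0⟩ := exists_log_path (γ := fun t => D.arc e t - p)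
    ((D.arc_continuous e).sub continuous_const) hne (w := Complex.log (D.pt (D.src e) - p))
    (by rw [Complex.exp_log h0, D.arc_zero])
  have h2 : Complex.exp (L 1) = Complex.exp (Complex.log (D.pt (D.tgt e) - p)) := by
    rw [hLe, Complex.exp_log h1, D.arc_one]
  obtain ⟨n, hn⟩ := Complex.exp_eq_exp_iff_exists_int.1 h2
  exact ⟨n, L, hL, hLe, hL0, by rw [hn]; ring⟩

open Classical in
/-- The number of extra turns around `p` that a logarithm of `z - p` makes along the edge `e`,
compared with the principal values at the two ends of `e`; it is `0` by convention if `p` lies on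
`e`. -/
noncomputable def turns (p : ℂ) (e : E) : ℤ :=
  if h : p ∉ Set.range (D.arc e) then (D.exists_turns p e h).choose else 0

theorem turns_spec {p : ℂ} {e : E} (h : p ∉ Set.range (D.arc e)) :
    ∃ L : I → ℂ, Continuous L ∧ (∀ t, Complex.exp (L t) = D.arc e t - p) ∧
      L 0 = Complex.log (D.pt (D.src e) - p) ∧
      L 1 = Complex.log (D.pt (D.tgt e) - p) + 2 * Real.pi * Complex.I * D.turns p e := by
  rw [turns, dif_pos h]
  exact (D.exists_turns p e h).choose_spec

theorem log_increment {p : ℂ} {e : E} (h : p ∉ Set.range (D.arc e)) {M : I → ℂ}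
    (hM : Continuous M) (hMe : ∀ t, Complex.exp (M t) = D.arc e t - p) :
    M 1 - M 0 = Complex.log (D.pt (D.tgt e) - p) - Complex.log (D.pt (D.src e) - p) +
      2 * Real.pi * Complex.I * D.turns p e := by
  obtain ⟨L, hL, hLe, hL0, hL1⟩ := D.turns_spec h
  have := log_sub_log_const isPreconnected_univ hM.continuousOn hL.continuousOn
    (fun t _ => by rw [hMe, hLe]) (Set.mem_univ (0 : I)) (Set.mem_univ (1 : I))
  rw [hL0, hL1] at this
  linear_combination -this

section
variable [Fintype E]

/-- The winding number of the cycle `z` around `p`. It is the sum of the extra turns because the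
principal values of the logarithm at the ends of the edges cancel along a cycle. It is defined for
all vectors `z`, but has this meaning only if `z` is a cycle whose edges avoid `p`. -/
noncomputable def wind (p : ℂ) : (E → ℚ) →ₗ[ℚ] ℚ where
  toFun z := ∑ e, z e * D.turns p e
  map_add' := by intro x y; simp [add_mul, Finset.sum_add_distrib]
  map_smul' := by intro c x; simp [mul_assoc, Finset.mul_sum]

theorem wind_apply (p : ℂ) (z : E → ℚ) : D.wind p z = ∑ e, z e * D.turns p e := rfl

omit [Fintype E] in
theorem notMem_range_of_notMem_body {A : Set E} {p : ℂ} (hp : p ∉ D.body A) {e : E} (he : e ∈ A) :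
    p ∉ Set.range (D.arc e) := by
  rintro ⟨t, ht⟩
  exact hp (ht ▸ D.arc_mem_body he t)

/-- For `q` close to `p` the quotient `(z - q) / (z - p)` takes values in the slit plane on the
drawing, so its principal logarithm turns a logarithm of `z - p` into one of `z - q`. -/
theorem wind_locally_const [Finite V] {A : Set E} {z : E → ℚ} (hz : z ∈ cyclesIn D.src D.tgt A)
    {p : ℂ}
    (hp : p ∉ D.body A) : ∀ᶠ q in nhds p, D.wind q z = D.wind p z := by
  obtain ⟨δ, hδ, hball⟩ := Metric.isOpen_iff.1 (D.isOpen_compl_body A) p hp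
  filter_upwards [Metric.ball_mem_nhds p hδ] with q hq
  have hqA : q ∉ D.body A := hball hq
  have hslit : ∀ x ∈ D.body A, (x - q) / (x - p) ∈ Complex.slitPlane := by
    intro x hx
    have h1 : δ ≤ ‖x - p‖ := by
      by_contra! h
      exact hball (by simpa [dist_eq_norm] using h) hx
    have h2 : x - p ≠ 0 := by
      intro h
      rw [h, norm_zero] at h1
      linarith
    have h3 : (x - q) / (x - p) = 1 + (p - q) / (x - p) := by
      field_simp
      ring
    rw [h3]
    apply Complex.mem_slitPlane_of_norm_lt_one
    rw [norm_div, div_lt_one (by linarith)]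
    have : ‖p - q‖ < δ := by rw [norm_sub_rev]; simpa [dist_eq_norm] using hq
    linarith
  let G : V → ℂ := fun v => Complex.log ((D.pt v - q) / (D.pt v - p)) -
    Complex.log (D.pt v - q) + Complex.log (D.pt v - p)
  have hG : ∀ e ∈ A, 2 * Real.pi * Complex.I * ((D.turns q e : ℂ) - D.turns p e) =
      G (D.tgt e) - G (D.src e) := by
    intro e he
    have hpe := D.notMem_range_of_notMem_body hp he
    have hqe := D.notMem_range_of_notMem_body hqA he
    have hne : ∀ t, D.arc e t - p ≠ 0 := fun t ht => hpe ⟨t, sub_eq_zero.1 ht⟩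
    obtain ⟨L, hL, hLe, hL0, hL1⟩ := D.turns_spec hpe
    have hM : Continuous fun t => L t + Complex.log ((D.arc e t - q) / (D.arc e t - p)) := by
      refine hL.add (Continuous.clog ?_ fun t => hslit _ (D.arc_mem_body he t))
      exact ((D.arc_continuous e).sub continuous_const).div
        ((D.arc_continuous e).sub continuous_const) hne
    have := D.log_increment hqe hM (by
      intro t
      rw [Complex.exp_add, hLe, Complex.exp_log]
      · field_simp [hne t]
      · exact Complex.slitPlane_ne_zero (hslit _ (D.arc_mem_body he t)))
    simp only [hL0, hL1, D.arc_zero, D.arc_one] at this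
    simp only [G]
    linear_combination -this
  have hsum := cycleSpace_sum_complex hz.1 G
  have h2 : (2 * Real.pi * Complex.I) * ((D.wind q z : ℂ) - D.wind p z) = 0 := by
    rw [← hsum, D.wind_apply, D.wind_apply]
    push_cast
    rw [← Finset.sum_sub_distrib, Finset.mul_sum]
    refine Finset.sum_congr rfl fun e _ => ?_
    by_cases he : e ∈ A
    · rw [← hG e he]; ring
    · rw [hz.2 e he]; simp
  have h3 : (D.wind q z : ℂ) = D.wind p z := by
    rcases mul_eq_zero.1 h2 with h | h
    · simp [Real.pi_ne_zero] at h
    · exact sub_eq_zero.1 h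
  exact_mod_cast h3

theorem wind_const [Finite V] {A : Set E} {z : E → ℚ} (hz : z ∈ cyclesIn D.src D.tgt A) {s : Set ℂ}
    (hs : IsPreconnected s) (hsA : Disjoint s (D.body A)) {p q : ℂ} (hp : p ∈ s) (hq : q ∈ s) :
    D.wind p z = D.wind q z := by
  have hsub : ∀ x ∈ s, x ∉ D.body A := fun x hx h => hsA.le_bot ⟨hx, h⟩
  have hopen : ∀ P : ℚ → Prop, IsOpen {x | x ∉ D.body A ∧ P (D.wind x z)} := by
    intro P
    rw [isOpen_iff_mem_nhds]
    rintro x ⟨hx, hxP⟩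
    filter_upwards [D.wind_locally_const hz hx, (D.isOpen_compl_body A).mem_nhds hx] with y hy hyA
    exact ⟨hyA, by rw [hy]; exact hxP⟩
  have := hs.subset_left_of_subset_union (hopen fun r => r = D.wind p z)
    (hopen fun r => r ≠ D.wind p z) (by
      rw [Set.disjoint_left]
      rintro x ⟨_, h1⟩ ⟨_, h2⟩
      exact h2 h1) (fun x hx => by
      by_cases h : D.wind x z = D.wind p z
      · exact Or.inl ⟨hsub x hx, h⟩
      · exact Or.inr ⟨hsub x hx, h⟩) ⟨p, hp, hsub p hp, rfl⟩
  exact (this hq).2.symm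

/-- Seen from a point far to the left, the drawing lies in the slit plane. -/
theorem wind_eq_zero_of_far {A : Set E} {z : E → ℚ} (hz : z ∈ cyclesIn D.src D.tgt A) {R : ℝ}
    (hR : D.body A ⊆ Metric.ball 0 R) : D.wind (-R : ℝ) z = 0 := by
  rw [wind_apply]
  refine Finset.sum_eq_zero fun e _ => ?_
  by_cases he : e ∈ A
  · have hslit : ∀ t, D.arc e t - ((-R : ℝ) : ℂ) ∈ Complex.slitPlane := by
      intro t
      have h1 : ‖D.arc e t‖ < R := by simpa using hR (D.arc_mem_body he t)
      have h2 := Complex.abs_re_le_norm (D.arc e t)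
      left
      simp only [Complex.sub_re, Complex.ofReal_re]
      linarith [neg_abs_le (D.arc e t).re]
    have hnot : ((-R : ℝ) : ℂ) ∉ Set.range (D.arc e) := by
      rintro ⟨t, ht⟩
      have := hslit t
      rw [ht, sub_self] at this
      exact Complex.slitPlane_ne_zero this rfl
    have := D.log_increment hnot
      (M := fun t => Complex.log (D.arc e t - ((-R : ℝ) : ℂ)))
      (Continuous.clog ((D.arc_continuous e).sub continuous_const) hslit)
      (fun t => Complex.exp_log (Complex.slitPlane_ne_zero (hslit t)))
    rw [D.arc_zero, D.arc_one] at this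
    have h2 : 2 * Real.pi * Complex.I * (D.turns ((-R : ℝ) : ℂ) e : ℂ) = 0 := by
      linear_combination -this
    have h3 : D.turns ((-R : ℝ) : ℂ) e = 0 := by
      rcases mul_eq_zero.1 h2 with h | h
      · simp [Real.pi_ne_zero] at h
      · exact_mod_cast h
    rw [h3]; simp
  · rw [hz.2 e he, zero_mul]

end

end ArcSystem

theorem continuousOn_range_of_comp {X Y Z : Type*} [TopologicalSpace X] [TopologicalSpace Y]
    [TopologicalSpace Z] [CompactSpace X] [T2Space Y] {γ : X → Y} (hγ : Continuous γ)
    (hi : Function.Injective γ) {h : Y → Z} (hh : Continuous (h ∘ γ)) :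
    ContinuousOn h (Set.range γ) := by
  have emb := (hγ.isClosedEmbedding hi).isEmbedding
  rw [continuousOn_iff_continuous_domRestrict]
  have : (Set.range γ).domRestrict h = (h ∘ γ) ∘ emb.toHomeomorph.symm := by
    ext ⟨_, x, rfl⟩
    have : emb.toHomeomorph.symm ⟨γ x, x, rfl⟩ = x := by
      rw [Homeomorph.symm_apply_eq]
      rfl
    simp [this]
  rw [this]
  exact hh.comp emb.toHomeomorph.symm.continuous

/-! ### Faces of a drawing -/

namespace ArcSystem

variable {V E : Type*} (D : ArcSystem V E)

/-- If the turns around the points `p i`, weighted by `c i`, add up to a coboundary on `A`, then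
logarithms of `∏ i, (z - p i) ^ c i` on the single edges can be chosen to agree at the vertices. -/
theorem exists_log_on_body [Finite E] {ι : Type*} [Fintype ι] {A : Set E} {p : ι → ℂ}
    (hp : ∀ i, p i ∉ D.body A) (c : ι → ℤ) (g : V → ℤ)
    (hg : ∀ e ∈ A, ∑ i, c i * D.turns (p i) e = g (D.tgt e) - g (D.src e)) :
    ∃ Λ : ℂ → ℂ, ContinuousOn Λ (D.body A) ∧
      ∀ x ∈ D.body A, Complex.exp (Λ x) = ∏ i, (x - p i) ^ c i := by
  classical
  let W : V → ℂ := fun v => ∑ i, c i * Complex.log (D.pt v - p i) + 2 * Real.pi * Complex.I * g v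
  have hℓ : ∀ e : E, ∃ ℓ : I → ℂ, e ∈ A → Continuous ℓ ∧
      (∀ t, Complex.exp (ℓ t) = ∏ i, (D.arc e t - p i) ^ c i) ∧
      ℓ 0 = W (D.src e) ∧ ℓ 1 = W (D.tgt e) := by
    intro e
    by_cases he : e ∈ A
    · choose L hL hLe hL0 hL1 using fun i =>
        D.turns_spec (D.notMem_range_of_notMem_body (hp i) he)
      refine ⟨fun t => ∑ i, c i * L i t + 2 * Real.pi * Complex.I * g (D.src e), fun _ =>
        ⟨by fun_prop, fun t => ?_, ?_, ?_⟩⟩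
      · have h1 : Complex.exp (2 * Real.pi * Complex.I * (g (D.src e))) = 1 :=
          Complex.exp_eq_one_iff.2 ⟨g (D.src e), by ring⟩
        rw [Complex.exp_add, h1, mul_one, Complex.exp_sum]
        refine Finset.prod_congr rfl fun i _ => ?_
        rw [Complex.exp_int_mul, hLe]
      · simp only [hL0, W]
      · simp only [hL1, W]
        have h2 : (∑ i, (c i : ℂ) * D.turns (p i) e) = g (D.tgt e) - g (D.src e) := by
          exact_mod_cast hg e he
        simp only [mul_add, Finset.sum_add_distrib]
        have h3 : ∑ i, (c i : ℂ) * (2 * Real.pi * Complex.I * D.turns (p i) e) =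
            2 * Real.pi * Complex.I * ∑ i, (c i : ℂ) * D.turns (p i) e := by
          rw [Finset.mul_sum]
          exact Finset.sum_congr rfl fun i _ => by ring
        rw [h3, h2]
        ring
    · exact ⟨0, fun h => absurd h he⟩
  choose ℓ hℓ using hℓ
  have hex : ∀ x ∈ D.body A, ∃ y : E × I, y.1 ∈ A ∧ D.arc y.1 y.2 = x := by
    intro x hx
    obtain ⟨e, he, t, ht⟩ := D.mem_body.1 hx
    exact ⟨(e, t), he, ht⟩
  let Λ : ℂ → ℂ := fun x => if h : x ∈ D.body A then
    ℓ (hex x h).choose.1 (hex x h).choose.2 else 0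
  -- the values on the edges agree at the vertices
  have hend : ∀ e ∈ A, ∀ t : I, t = 0 ∨ t = 1 → ∃ v, D.arc e t = D.pt v ∧ ℓ e t = W v := by
    intro e he t ht
    rcases ht with rfl | rfl
    · exact ⟨_, D.arc_zero e, (hℓ e he).2.2.1⟩
    · exact ⟨_, D.arc_one e, (hℓ e he).2.2.2⟩
  have hΛ : ∀ e ∈ A, ∀ t, Λ (D.arc e t) = ℓ e t := by
    intro e he t
    have hb := D.arc_mem_body he t
    obtain ⟨h1, h2⟩ := (hex _ hb).choose_spec
    simp only [Λ, hb, dite_true]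
    rcases D.arc_eq_arc h2 with ⟨h3, h4⟩ | ⟨h3, h4⟩
    · rw [h3, h4]
    · obtain ⟨v, hv, hv'⟩ := hend _ h1 _ h3
      obtain ⟨w, hw, hw'⟩ := hend e he _ h4
      rw [hv', hw', D.pt_injective (hv.symm.trans (h2.trans hw))]
  refine ⟨Λ, ?_, ?_⟩
  · have hU : D.body A = ⋃ e : A, Set.range (D.arc e) := by simp [body, Set.iUnion_subtype]
    rw [hU]
    refine LocallyFinite.continuousOn_iUnion (locallyFinite_of_finite _)
      (fun e => (isCompact_range (D.arc_continuous _)).isClosed) fun e => ?_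
    refine continuousOn_range_of_comp (D.arc_continuous _) (D.arc_injective _) ?_
    have : Λ ∘ D.arc e = ℓ e := funext fun t => hΛ e e.2 t
    rw [this]
    exact (hℓ e e.2).1
  · intro x hx
    obtain ⟨e, he, t, rfl⟩ := D.mem_body.1 hx
    rw [hΛ e he, (hℓ e he).2.1]

/-- The face of `p` in the drawing of the edges in `A`. -/
def face (A : Set E) (p : ℂ) : Set ℂ := connectedComponentIn (D.body A)ᶜ p

theorem mem_face {A : Set E} {p : ℂ} (hp : p ∉ D.body A) : p ∈ D.face A p :=
  mem_connectedComponentIn hp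

theorem face_disjoint_body (A : Set E) (p : ℂ) : Disjoint (D.face A p) (D.body A) :=
  Set.disjoint_left.2 fun _ hx => connectedComponentIn_subset _ _ hx

theorem face_eq {A : Set E} {p q : ℂ} (h : q ∈ D.face A p) : D.face A q = D.face A p :=
  (connectedComponentIn_eq h).symm

theorem face_eq_of_isPreconnected {A : Set E} {s : Set ℂ} (hs : IsPreconnected s)
    (hsA : Disjoint s (D.body A)) {p q : ℂ} (hp : p ∈ s) (hq : q ∈ s) :
    D.face A p = D.face A q :=
  connectedComponentIn_eq (hs.subset_connectedComponentIn hp hsA.subset_compl_right hq)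

theorem isPreconnected_face (A : Set E) (p : ℂ) : IsPreconnected (D.face A p) :=
  isPreconnected_connectedComponentIn

theorem isOpen_face [Finite E] (A : Set E) (p : ℂ) : IsOpen (D.face A p) :=
  (D.isOpen_compl_body A).connectedComponentIn

theorem closure_face_subset [Finite E] (A : Set E) (p : ℂ) :
    closure (D.face A p) ⊆ D.face A p ∪ D.body A := by
  intro x hx
  by_cases hxA : x ∈ D.body A
  · exact Or.inr hxA
  · left
    obtain ⟨y, hy1, hy2⟩ := mem_closure_iff.1 hx _ (D.isOpen_face A x) (D.mem_face hxA)
    rw [← D.face_eq hy2, D.face_eq hy1]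
    exact D.mem_face hxA

theorem frontier_face_subset [Finite E] (A : Set E) (p : ℂ) :
    frontier (D.face A p) ⊆ D.body A := by
  intro x hx
  rw [(D.isOpen_face A p).frontier_eq] at hx
  exact (D.closure_face_subset A p hx.1).resolve_left hx.2

variable [Fintype E] [Finite V]

/-- The winding numbers around points in distinct bounded faces are linearly independent: a relation
makes a combination of turns a coboundary, hence gives a logarithm of a product of powers of the
`z - p i` on the drawing, which contradicts Eilenberg's criterion. -/
theorem eq_zero_of_sum_wind_eq_zero {ι : Type*} [Fintype ι] {A : Set E} {p : ι → ℂ}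
    (hp : ∀ i, p i ∉ D.body A) (hface : Function.Injective fun i => D.face A (p i))
    (hbdd : ∀ i, Bornology.IsBounded (D.face A (p i))) {c : ι → ℚ}
    (hc : ∀ z ∈ cyclesIn D.src D.tgt A, ∑ i, c i * D.wind (p i) z = 0) : c = 0 := by
  classical
  obtain ⟨g, hg⟩ := exists_potential (src := D.src) (tgt := D.tgt) (A := A)
    (N := fun e => ∑ i, c i * D.turns (p i) e) (by
      intro z hz
      rw [← hc z hz]
      simp only [wind_apply, Finset.mul_sum]
      rw [Finset.sum_comm]
      refine Finset.sum_congr rfl fun i _ => Finset.sum_congr rfl fun e _ => by ring)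
  -- clear denominators
  obtain ⟨b, hb⟩ := IsLocalization.exist_integer_multiples_of_finite (nonZeroDivisors ℤ)
    (Sum.elim c g : ι ⊕ V → ℚ)
  have hb0 : (b : ℤ) ≠ 0 := nonZeroDivisors.coe_ne_zero b
  choose F hF using hb
  have hFc : ∀ i, ((F (Sum.inl i) : ℤ) : ℚ) = (b : ℤ) * c i := by
    intro i
    simpa using hF (Sum.inl i)
  have hFg : ∀ v, ((F (Sum.inr v) : ℤ) : ℚ) = (b : ℤ) * g v := by
    intro v
    simpa using hF (Sum.inr v)
  obtain ⟨Λ, hΛ, hΛe⟩ := D.exists_log_on_body hp (fun i => F (Sum.inl i)) (fun v => F (Sum.inr v))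
      (by
    intro e he
    have h1 := hg e he
    have h2 : ((∑ i, F (Sum.inl i) * D.turns (p i) e : ℤ) : ℚ) =
        ((F (Sum.inr (D.tgt e)) - F (Sum.inr (D.src e)) : ℤ) : ℚ) := by
      push_cast
      rw [hFg, hFg, ← mul_sub, ← h1, Finset.mul_sum]
      refine Finset.sum_congr rfl fun i _ => ?_
      rw [hFc]; ring
    exact_mod_cast h2)
  ext j
  by_contra hj
  have hFj : F (Sum.inl j) ≠ 0 := by
    intro h
    have := hFc j
    rw [h] at this
    have h0 : ((b : ℤ) : ℚ) ≠ 0 := by exact_mod_cast hb0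
    simp only [Int.cast_zero] at this
    exact (mul_ne_zero h0 hj) this.symm
  have hout : ∀ i, i ≠ j → p i ∉ closure (D.face A (p j)) := by
    intro i hij h
    rcases D.closure_face_subset A _ h with h | h
    · exact hij (hface (D.face_eq h))
    · exact hp i h
  refine no_log_on_frontier (D.isOpen_face A (p j)) (hbdd j) (D.isCompact_body A).isClosed
    (D.frontier_face_subset A (p j)) (D.mem_face (hp j)) hFj
    (Q := fun x => ∏ i ∈ Finset.univ.erase j, (x - p i) ^ F (Sum.inl i)) ?_ ?_ hΛ ?_
  · refine continuousOn_finsetProd _ fun i hi => ?_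
    refine ContinuousOn.zpow₀ (by fun_prop) _ fun x hx => Or.inl ?_
    intro h
    exact hout i (Finset.ne_of_mem_erase hi) (by rwa [← sub_eq_zero.1 h])
  · intro x hx
    refine Finset.prod_ne_zero_iff.2 fun i hi => zpow_ne_zero _ ?_
    intro h
    exact hout i (Finset.ne_of_mem_erase hi) (by rwa [← sub_eq_zero.1 h])
  · intro x hx
    rw [hΛe x hx, Finset.mul_prod_erase Finset.univ (fun i => (x - p i) ^ F (Sum.inl i))
      (Finset.mem_univ j)]

/-- Winding numbers around points in distinct bounded faces can be prescribed. -/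
theorem exists_cycle_of_bounded {ι : Type*} [Finite ι] {A : Set E} {p : ι → ℂ}
    (hp : ∀ i, p i ∉ D.body A) (hface : Function.Injective fun i => D.face A (p i))
    (hbdd : ∀ i, Bornology.IsBounded (D.face A (p i))) (φ : ι → ℚ) :
    ∃ z ∈ cyclesIn D.src D.tgt A, ∀ i, D.wind (p i) z = φ i := by
  classical
  have := Fintype.ofFinite ι
  let Φ : (E → ℚ) →ₗ[ℚ] (ι → ℚ) := LinearMap.pi fun i => D.wind (p i)
  have hΦ : φ ∈ (cyclesIn D.src D.tgt A).map Φ := by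
    by_contra hcon
    obtain ⟨f, hf, hle⟩ := Submodule.exists_le_ker_of_notMem hcon
    have hfs : ∀ x : ι → ℚ, f x = ∑ i, f (Pi.single i 1) * x i := f.apply_eq_sum_single
    have h0 := D.eq_zero_of_sum_wind_eq_zero hp hface hbdd (c := fun i => f (Pi.single i 1)) (by
      intro z hz
      have := hle (Submodule.mem_map_of_mem (f := Φ) hz)
      rw [LinearMap.mem_ker, hfs] at this
      exact this)
    apply hf
    rw [hfs]
    exact Finset.sum_eq_zero fun i _ => by rw [congrFun h0 i]; simp
  obtain ⟨z, hz, hzφ⟩ := hΦ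
  exact ⟨z, hz, fun i => congrFun hzφ i⟩

omit [Finite V] in
/-- There is one unbounded face, and all winding numbers vanish there. -/
theorem exists_outer_point (A : Set E) : ∃ o : ℂ, o ∉ D.body A ∧
    (∀ z ∈ cyclesIn D.src D.tgt A, D.wind o z = 0) ∧
    ∀ q ∉ D.body A, ¬ Bornology.IsBounded (D.face A q) → D.face A q = D.face A o := by
  obtain ⟨R, hR0, hR⟩ := (D.isCompact_body A).isBounded.subset_ball_lt 0 0
  refine ⟨((-R : ℝ) : ℂ), ?_, fun z hz => D.wind_eq_zero_of_far hz hR, ?_⟩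
  · intro h
    have := hR h
    simp only [Metric.mem_ball, dist_zero_right, Complex.norm_real, Real.norm_eq_abs] at this
    rw [abs_neg] at this
    exact absurd this (not_lt.2 (le_abs_self R))
  · intro q hq hub
    obtain ⟨x, hx, hxR⟩ : ∃ x ∈ D.face A q, x ∉ Metric.ball (0 : ℂ) R := by
      by_contra! h
      exact hub (Metric.isBounded_ball.subset h)
    have hconn : IsPreconnected (Metric.ball (0 : ℂ) R)ᶜ := by
      -- it is the image under `exp` of a half-plane
      have himg : (Metric.ball (0 : ℂ) R)ᶜ = Complex.exp '' {z | Real.log R ≤ z.re} := by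
        ext z
        simp only [Set.mem_compl_iff, Metric.mem_ball, dist_zero_right, not_lt, Set.mem_image,
          Set.mem_ofPred_eq]
        constructor
        · intro hz
          have hz0 : z ≠ 0 := norm_pos_iff.1 (hR0.trans_le hz)
          exact ⟨Complex.log z, by rw [Complex.log_re]; exact Real.log_le_log hR0 hz,
            Complex.exp_log hz0⟩
        · rintro ⟨w, hw, rfl⟩
          rw [Complex.norm_exp, ← Real.exp_log hR0]
          exact Real.exp_le_exp.2 hw
      rw [himg]
      exact (convex_halfSpace_re_ge _).isPreconnected.image _ Complex.continuous_exp.continuousOn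
    have hdisj : Disjoint (Metric.ball (0 : ℂ) R)ᶜ (D.body A) := by
      rw [Set.disjoint_left]
      intro y hy hyA
      exact hy (hR hyA)
    rw [← D.face_eq hx]
    refine D.face_eq_of_isPreconnected hconn hdisj hxR ?_
    simp [le_abs_self]

/-- Winding numbers around points in distinct faces can be prescribed up to a common constant. -/
theorem exists_cycle_of_faces {ι : Type*} [Finite ι] {A : Set E} {p : ι → ℂ}
    (hp : ∀ i, p i ∉ D.body A) (hface : Function.Injective fun i => D.face A (p i)) (φ : ι → ℚ) :
    ∃ z ∈ cyclesIn D.src D.tgt A, ∃ c, ∀ i, D.wind (p i) z = φ i + c := by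
  classical
  obtain ⟨o, ho, ho0, houter⟩ := D.exists_outer_point A
  by_cases hall : ∀ i, Bornology.IsBounded (D.face A (p i))
  · obtain ⟨z, hz, h⟩ := D.exists_cycle_of_bounded hp hface hall φ
    exact ⟨z, hz, 0, fun i => by rw [h, add_zero]⟩
  · push Not at hall
    obtain ⟨j, hj⟩ := hall
    have hjo := houter _ (hp j) hj
    obtain ⟨z, hz, h⟩ := D.exists_cycle_of_bounded (ι := {i // i ≠ j}) (p := fun i => p i)
      (fun i => hp i) (fun a b hab => Subtype.ext (hface hab)) (by
        intro i
        by_contra hi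
        exact i.2 (hface ((houter _ (hp i) hi).trans hjo.symm))) (fun i => φ i - φ j)
    refine ⟨z, hz, -φ j, fun i => ?_⟩
    by_cases hij : i = j
    · subst hij
      rw [D.wind_const hz (D.isPreconnected_face A o) (D.face_disjoint_body A o)
        (p := p i) (q := o) (by rw [← hjo]; exact D.mem_face (hp i)) (D.mem_face ho), ho0 z hz]
      ring
    · rw [h ⟨i, hij⟩]; ring

theorem exists_cycle_of_face_ne {A : Set E} {p q : ℂ} (hp : p ∉ D.body A) (hq : q ∉ D.body A)
    (h : D.face A p ≠ D.face A q) : ∃ z ∈ cyclesIn D.src D.tgt A, D.wind p z ≠ D.wind q z := by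
  obtain ⟨z, hz, c, hc⟩ := D.exists_cycle_of_faces (ι := Bool) (A := A)
    (p := fun b => if b then p else q) (by rintro (_ | _) <;> simpa) (by
      rintro (_ | _) (_ | _) hab
      · rfl
      · simp at hab; exact absurd hab.symm h
      · simp at hab; exact absurd hab h
      · rfl) (fun b => if b then 1 else 0)
  refine ⟨z, hz, ?_⟩
  have h1 := hc true
  have h2 := hc false
  simp only [if_true] at h1
  simp only [Bool.false_eq_true, if_false] at h2
  rw [h1, h2]
  intro h
  linarith

/-- A forest does not separate the plane. -/
theorem isPreconnected_compl_body {A : Set E} (hA : ∀ z ∈ cyclesIn D.src D.tgt A, z = 0) :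
    IsPreconnected (D.body A)ᶜ := by
  refine isPreconnected_of_forall_pair fun x hx y hy => ?_
  refine ⟨D.face A x, connectedComponentIn_subset _ _, D.mem_face hx, ?_, D.isPreconnected_face A x⟩
  by_contra h
  obtain ⟨z, hz, hne⟩ := D.exists_cycle_of_face_ne hx hy (by
    intro he
    apply h
    rw [he]
    exact D.mem_face hy)
  rw [hA z hz] at hne
  simp at hne

end ArcSystem

/-! ### The dual graph -/

namespace ArcSystem

variable {V E : Type*} (D : ArcSystem V E)

/-- The midpoint of an edge. -/
noncomputable def mid (e : E) : ℂ := D.arc e ⟨1 / 2, by norm_num, by norm_num⟩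

theorem half_mem_Ioo : (⟨1 / 2, by norm_num, by norm_num⟩ : I) ∈ Set.Ioo (0 : I) 1 := by
  constructor <;> rw [← Subtype.coe_lt_coe] <;> norm_num

theorem arc_notMem_body {A : Set E} {e : E} (he : e ∉ A) {t : I} (ht : t ∈ Set.Ioo (0 : I) 1) :
    D.arc e t ∉ D.body A := by
  intro h
  obtain ⟨f, hf, s, hs⟩ := D.mem_body.1 h
  rcases D.arc_eq_arc hs with ⟨rfl, -⟩ | ⟨-, rfl | rfl⟩
  · exact he hf
  · exact lt_irrefl _ ht.1
  · exact lt_irrefl _ ht.2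

theorem mid_notMem_body {A : Set E} {e : E} (he : e ∉ A) : D.mid e ∉ D.body A :=
  D.arc_notMem_body he half_mem_Ioo

/-- The component of the complement of all other edges that contains the interior of `e`. -/
def edgeRegion (e : E) : Set ℂ := D.face {e}ᶜ (D.mid e)

theorem arc_mem_edgeRegion (e : E) {t : I} (ht : t ∈ Set.Ioo (0 : I) 1) :
    D.arc e t ∈ D.edgeRegion e := by
  have hs : IsPreconnected (D.arc e '' Set.Ioo (0 : I) 1) :=
    isPreconnected_Ioo.image _ (D.arc_continuous e).continuousOn
  refine hs.subset_connectedComponentIn ⟨_, half_mem_Ioo, rfl⟩ ?_ ⟨t, ht, rfl⟩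
  rintro _ ⟨s, hs, rfl⟩
  exact D.arc_notMem_body (by simp) hs

theorem edgeRegion_disjoint (e : E) : Disjoint (D.edgeRegion e) (D.body {e}ᶜ) :=
  D.face_disjoint_body _ _

theorem notMem_body_univ {e : E} {p : ℂ} (hp : p ∈ D.edgeRegion e) (hpe : p ∉ Set.range (D.arc e)) :
    p ∉ D.body Set.univ := by
  intro h
  obtain ⟨f, -, s, hs⟩ := D.mem_body.1 h
  by_cases hfe : f = e
  · subst hfe
    exact hpe ⟨s, hs⟩
  · exact (D.edgeRegion_disjoint e).le_bot ⟨hp, D.mem_body.2 ⟨f, hfe, s, hs⟩⟩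

theorem src_ne_tgt (e : E) : D.src e ≠ D.tgt e := by
  intro h
  have : D.arc e 0 = D.arc e 1 := by rw [D.arc_zero, D.arc_one, h]
  exact zero_ne_one (D.arc_injective e this)

theorem range_inter_body_subset {A : Set E} {e : E} (he : e ∉ A) :
    Set.range (D.arc e) ∩ D.body A ⊆ {D.pt (D.src e), D.pt (D.tgt e)} := by
  rintro _ ⟨⟨t, rfl⟩, h⟩
  rcases unitInterval.eq_zero_or_one_or_mem_Ioo t with rfl | rfl | ht
  · simp [D.arc_zero]
  · simp [D.arc_one]
  · exact absurd h (D.arc_notMem_body he ht)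

/-- A region is not contained in the edge: otherwise its frontier would consist of at most the two
ends of the edge, and any nonvanishing function has a continuous logarithm on a finite set. -/
theorem exists_mem_edgeRegion [Finite E] (e : E) :
    ∃ p ∈ D.edgeRegion e, p ∉ Set.range (D.arc e) := by
  by_contra! hcon
  have hY : closure (D.edgeRegion e) ⊆ Set.range (D.arc e) :=
    closure_minimal hcon (isCompact_range (D.arc_continuous e)).isClosed
  have hfin : ({D.pt (D.src e), D.pt (D.tgt e)} : Set ℂ).Finite := Set.toFinite _
  have hfr : frontier (D.edgeRegion e) ⊆ {D.pt (D.src e), D.pt (D.tgt e)} := fun x hx =>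
    D.range_inter_body_subset (A := {e}ᶜ) (by simp)
      ⟨hY (frontier_subset_closure hx), D.frontier_face_subset _ _ hx⟩
  have hends : ∀ z ∈ ({D.pt (D.src e), D.pt (D.tgt e)} : Set ℂ), z - D.mid e ≠ 0 := by
    intro z hz h
    rw [sub_eq_zero] at h
    rcases hz with hz | hz
    · exact D.arc_ne_pt e _ half_mem_Ioo _ (h.symm.trans hz)
    · exact D.arc_ne_pt e _ half_mem_Ioo _ (h.symm.trans hz)
  refine no_log_on_frontier (D.isOpen_face _ _)
    ((isCompact_range (D.arc_continuous e)).isBounded.subset (subset_closure.trans hY))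
    hfin.isClosed hfr (D.mem_face (D.mid_notMem_body (by simp))) (k := 1) one_ne_zero
    (Q := fun _ => 1) continuousOn_const (fun _ _ => one_ne_zero)
    (g := fun z => Complex.log (z - D.mid e)) (hfin.continuousOn _) ?_
  intro z hz
  rw [Complex.exp_log (hends z hz)]
  simp

theorem joinedIn_body_of_joinedBy {A : Set E} {u v : V} (h : JoinedBy D.src D.tgt A u v) :
    u = v ∨ JoinedIn (D.body A) (D.pt u) (D.pt v) := by
  induction h with
  | rel x y h =>
    obtain ⟨e, he, rfl, rfl⟩ := h
    refine Or.inr ⟨⟨⟨D.arc e, D.arc_continuous e⟩, D.arc_zero e, D.arc_one e⟩, fun t => ?_⟩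
    exact D.arc_mem_body he t
  | refl x => exact Or.inl rfl
  | symm x y _ ih => exact ih.imp Eq.symm JoinedIn.symm
  | trans x y z _ _ ih1 ih2 =>
    rcases ih1 with rfl | h1
    · exact ih2
    · rcases ih2 with rfl | h2
      · exact Or.inr h1
      · exact Or.inr (h1.trans h2)

variable [Fintype E] [Finite V]

/-- An edge that lies on a cycle has different faces on its two sides. -/
theorem exists_face_ne {e : E} (hjoin : JoinedBy D.src D.tgt {e}ᶜ (D.src e) (D.tgt e)) :
    ∃ p ∈ D.edgeRegion e, ∃ q ∈ D.edgeRegion e, p ∉ Set.range (D.arc e) ∧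
      q ∉ Set.range (D.arc e) ∧ D.face Set.univ p ≠ D.face Set.univ q := by
  by_contra! hcon
  -- `e` and a path `B` together separate the plane. But if all faces beside `e` coincide, they lie in
  -- one component `C` of the complement, and restoring the interior of `e` enlarges only `C`; as the
  -- complement of the forest `B` is connected, `C` was everything.
  obtain ⟨B, hBe, hB, hB0⟩ := exists_acyclic_joinedBy hjoin
  have hjB := (D.joinedIn_body_of_joinedBy hB).resolve_left (D.src_ne_tgt e)
  have heB : e ∉ B := fun h => hBe h rfl
  have hK₁ : IsCompact (Set.range (D.arc e)) := isCompact_range (D.arc_continuous e)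
  have hK₂ := D.isCompact_body B
  refine not_isPreconnected_compl_union hK₁ hK₂
    (D.pt_injective.ne (D.src_ne_tgt e))
        ⟨⟨⟨D.arc e, D.arc_continuous e⟩, D.arc_zero e, D.arc_one e⟩,
      fun t => ⟨t, rfl⟩⟩ hjB (D.range_inter_body_subset heB) ?_
  set S : Set ℂ := (Set.range (D.arc e) ∪ D.body B)ᶜ with hS
  have hSo : IsOpen S := (hK₁.union hK₂).isClosed.isOpen_compl
  obtain ⟨o, hoY, hoe⟩ := D.exists_mem_edgeRegion e
  have hSuniv : (D.body Set.univ)ᶜ ⊆ S := by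
    rw [hS, Set.compl_subset_compl]
    rintro x (⟨t, rfl⟩ | hx)
    · exact D.arc_mem_body (Set.mem_univ e) t
    · exact D.body_mono (Set.subset_univ B) hx
  set C := connectedComponentIn S o with hC
  have hoS : o ∈ S := hSuniv (D.notMem_body_univ hoY hoe)
  have hYC : ∀ x ∈ D.edgeRegion e, x ∉ Set.range (D.arc e) → x ∈ C := by
    intro x hx hxe
    have h1 := hcon o hoY x hx hoe hxe
    have h2 : x ∈ D.face Set.univ o := by
      rw [h1]
      exact D.mem_face (D.notMem_body_univ hx hxe)
    exact connectedComponentIn_mono o hSuniv h2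
  have hvo : IsOpen {x | x ∈ S ∧ x ∉ C} := by
    rw [isOpen_iff_forall_mem_open]
    rintro x ⟨hxS, hxC⟩
    refine ⟨connectedComponentIn S x, ?_, hSo.connectedComponentIn, mem_connectedComponentIn hxS⟩
    intro y hy
    refine ⟨connectedComponentIn_subset _ _ hy, fun hyC => hxC ?_⟩
    rw [hC, connectedComponentIn_eq hyC, ← connectedComponentIn_eq hy]
    exact mem_connectedComponentIn hxS
  have hsub := IsPreconnected.subset_left_of_subset_union (s := (D.body B)ᶜ)
    (u := C ∪ D.edgeRegion e) (v := {x | x ∈ S ∧ x ∉ C})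
    ((hSo.connectedComponentIn).union (D.isOpen_face _ _)) hvo (by
      rw [Set.disjoint_left]
      rintro x (hx | hx) ⟨hxS, hxC⟩
      · exact hxC hx
      · exact hxC (hYC x hx fun h => hxS (Or.inl h))) (by
      intro x hx
      by_cases hxe : x ∈ Set.range (D.arc e)
      · obtain ⟨t, rfl⟩ := hxe
        rcases unitInterval.eq_zero_or_one_or_mem_Ioo t with rfl | rfl | ht
        · rw [D.arc_zero] at hx
          exact absurd hjB.source_mem hx
        · rw [D.arc_one] at hx
          exact absurd hjB.target_mem hx
        · exact Or.inl (Or.inr (D.arc_mem_edgeRegion e ht))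
      · by_cases hxC : x ∈ C
        · exact Or.inl (Or.inl hxC)
        · exact Or.inr ⟨fun h => h.elim hxe hx, hxC⟩)
    ⟨o, (fun h => hoS (Or.inr h) : o ∈ (D.body B)ᶜ), Or.inl (mem_connectedComponentIn hoS)⟩
        (D.isPreconnected_compl_body hB0)
  have hSC : S ⊆ C := by
    intro x hx
    rcases hsub (fun h => hx (Or.inr h) : x ∈ (D.body B)ᶜ) with h | h
    · exact h
    · exact hYC x h fun h' => hx (Or.inl h')
  have : S = C := hSC.antisymm (connectedComponentIn_subset _ _)
  rw [this]
  exact isPreconnected_connectedComponentIn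

/-- The winding numbers of cycles around suitable points on the two sides of `e` differ by a
nonzero multiple of the coefficient of `e`. -/
theorem exists_sides (e : E) : ∃ p ∈ D.edgeRegion e, ∃ q ∈ D.edgeRegion e,
    p ∉ D.body Set.univ ∧ q ∉ D.body Set.univ ∧ ∃ s : ℚ, s ≠ 0 ∧
      ∀ z ∈ cycleSpace D.src D.tgt, D.wind p z - D.wind q z = s * z e := by
  have hsame : ∀ p ∈ D.edgeRegion e, ∀ q ∈ D.edgeRegion e, ∀ z ∈ cycleSpace D.src D.tgt,
      z e = 0 → D.wind p z = D.wind q z := by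
    intro p hp q hq z hz hze
    refine D.wind_const (A := {e}ᶜ) ⟨hz, ?_⟩ (D.isPreconnected_face _ _)
        (D.edgeRegion_disjoint e) hp hq
    intro f hf
    rw [show f = e by simpa using hf, hze]
  by_cases hbr : ∀ z ∈ cycleSpace D.src D.tgt, z e = 0
  · obtain ⟨p, hp, hpe⟩ := D.exists_mem_edgeRegion e
    refine ⟨p, hp, p, hp, D.notMem_body_univ hp hpe, D.notMem_body_univ hp hpe, 1, one_ne_zero, ?_⟩
    intro z hz
    rw [hbr z hz]
    ring
  · push Not at hbr
    obtain ⟨z₁, hz₁, hz₁e⟩ := hbr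
    have hjoin : JoinedBy D.src D.tgt {e}ᶜ (D.src e) (D.tgt e) := by
      have := joinedBy_of_mem_cyclesIn (A := Set.univ) ⟨hz₁, by simp⟩ hz₁e
      rwa [← Set.compl_eq_univ_sdiff] at this
    obtain ⟨p, hp, q, hq, hpe, hqe, hne⟩ := D.exists_face_ne hjoin
    have hp' := D.notMem_body_univ hp hpe
    have hq' := D.notMem_body_univ hq hqe
    have hlin : ∀ z ∈ cycleSpace D.src D.tgt, D.wind p z - D.wind q z =
        ((D.wind p z₁ - D.wind q z₁) / z₁ e) * z e := by
      intro z hz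
      have h1 := hsame p hp q hq (z - (z e / z₁ e) • z₁)
        (Submodule.sub_mem _ hz (Submodule.smul_mem _ _ hz₁)) (by
          simp [div_mul_cancel₀ _ hz₁e])
      simp only [map_sub, map_smul, smul_eq_mul] at h1
      linear_combination h1
    refine ⟨p, hp, q, hq, hp', hq', _, ?_, hlin⟩
    intro h0
    obtain ⟨z, hz, hzne⟩ := D.exists_cycle_of_face_ne hp' hq' hne
    have := hlin z hz.1
    rw [h0, zero_mul] at this
    exact hzne (sub_eq_zero.1 this)

omit [Fintype E] [Finite V] in
/-- Points beside an edge at `v` lie in the face of `v` in the drawing of the edges not at `v`. -/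
theorem mem_face_pt {v : V} {e : E} (hv : D.src e = v ∨ D.tgt e = v) {p : ℂ}
    (hp : p ∈ D.edgeRegion e) : p ∈ D.face {f | D.src f ≠ v ∧ D.tgt f ≠ v} (D.pt v) := by
  set A : Set E := {f | D.src f ≠ v ∧ D.tgt f ≠ v} with hA
  have heA : e ∉ A := by rintro ⟨h1, h2⟩; exact hv.elim h1 h2
  have hvA : D.pt v ∉ D.body A := by
    intro h
    obtain ⟨f, hf, t, ht⟩ := D.mem_body.1 h
    rcases unitInterval.eq_zero_or_one_or_mem_Ioo t with rfl | rfl | h'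
    · rw [D.arc_zero] at ht
      exact hf.1 (D.pt_injective ht)
    · rw [D.arc_one] at ht
      exact hf.2 (D.pt_injective ht)
    · exact D.arc_ne_pt f t h' v ht
  have hmid : D.mid e ∈ D.face A (D.pt v) := by
    have key : ∀ s : Set I, IsPreconnected s → ∀ t₀ ∈ s, D.arc e t₀ = D.pt v →
        (∀ t ∈ s, t = t₀ ∨ t ∈ Set.Ioo (0 : I) 1) →
        (⟨1 / 2, by norm_num, by norm_num⟩ : I) ∈ s → D.mid e ∈ D.face A (D.pt v) := by
      intro s hs t₀ ht₀ hv₀ hst hhalf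
      have := (hs.image _ (D.arc_continuous e).continuousOn).subset_connectedComponentIn
        (F := (D.body A)ᶜ) (x := D.pt v) ⟨t₀, ht₀, hv₀⟩ (by
          rintro _ ⟨t, ht, rfl⟩
          rcases hst t ht with rfl | h
          · rw [hv₀]; exact hvA
          · exact D.arc_notMem_body heA h)
      exact this ⟨_, hhalf, rfl⟩
    rcases hv with hv | hv
    · refine key (Set.Ico 0 1) isPreconnected_Ico 0 ⟨le_rfl, zero_lt_one⟩
        (by rw [D.arc_zero, hv]) (fun t ht => ?_) ⟨half_mem_Ioo.1.le, half_mem_Ioo.2⟩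
      rcases ht.1.eq_or_lt with h | h
      · exact Or.inl h.symm
      · exact Or.inr ⟨h, ht.2⟩
    · refine key (Set.Ioc 0 1) isPreconnected_Ioc 1 ⟨zero_lt_one, le_rfl⟩
        (by rw [D.arc_one, hv]) (fun t ht => ?_) ⟨half_mem_Ioo.1, half_mem_Ioo.2.le⟩
      rcases ht.2.eq_or_lt with h | h
      · exact Or.inl h
      · exact Or.inr ⟨ht.1, h⟩
  rw [← D.face_eq hmid]
  refine connectedComponentIn_mono _ ?_ hp
  rw [Set.compl_subset_compl]
  refine D.body_mono ?_
  intro f hf hfe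
  rw [Set.mem_singleton_iff] at hfe
  exact heA (hfe ▸ hf)

end ArcSystem

/-- A dual graph of the multigraph given by `src` and `tgt`, with vertices (faces) `F` and edges
`e` from `left e` to `right e`, in algebraic form: up to the nonzero scaling factors `scale e` the
cycle space is the space of coboundaries of functions on the faces. Connectedness of a set of edges
is expressed by saying that a function on the faces that does not change across these edges is
constant. The scaling factors stand for signs and need not be normalized. -/
structure DualGraph {V E : Type*} [Fintype E] (src tgt : E → V) (F : Type*) where
  /-- the face on one side of an edge -/
  left : E → F
  /-- the face on the other side of an edge -/
  right : E → F
  /-- the jump, across an edge, of the winding numbers of a cycle that uses this edge once -/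
  scale : E → ℚ
  scale_ne_zero : ∀ e, scale e ≠ 0
  exists_potential : ∀ z ∈ cycleSpace src tgt, ∃ φ : F → ℚ, ∀ e,
    scale e * z e = φ (left e) - φ (right e)
  exists_cycle : ∀ φ : F → ℚ, ∃ z ∈ cycleSpace src tgt, ∀ e,
    scale e * z e = φ (left e) - φ (right e)
  connected : ∀ φ : F → ℚ, (∀ e, φ (left e) = φ (right e)) → ∀ f g, φ f = φ g
  /-- the faces around a vertex are joined by the edges at this vertex -/
  star_connected : ∀ v, ∀ φ : F → ℚ,
    (∀ e, src e = v ∨ tgt e = v → φ (left e) = φ (right e)) →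
    ∀ e e', (src e = v ∨ tgt e = v) → (src e' = v ∨ tgt e' = v) → φ (left e) = φ (left e')

/-- Every crossing-free drawing of a finite multigraph has a dual graph: the faces are the
components of the complement that lie beside some edge, and the potential of a cycle is its winding
number. -/
theorem ArcSystem.exists_dualGraph {V E : Type*} [Finite V] [Fintype E] (D : ArcSystem V E) :
    ∃ F : Type, Finite F ∧ Nonempty (DualGraph D.src D.tgt F) := by
  choose p hp q hq hpu hqu s hs hsz using D.exists_sides
  let side : E × Bool → ℂ := fun x => if x.2 then p x.1 else q x.1
  have hside : ∀ x, side x ∉ D.body Set.univ := by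
    rintro ⟨e, _ | _⟩
    · exact hqu e
    · exact hpu e
  let F : Type := Set.range fun x => D.face Set.univ (side x)
  have hF : Finite F := Set.finite_range _
  choose rep hrep using fun f : F => f.2
  have hrepu : ∀ f, side (rep f) ∉ D.body Set.univ := fun f => hside _
  have hrepi : Function.Injective fun f => D.face Set.univ (side (rep f)) := by
    intro f g h
    apply Subtype.ext
    rw [← hrep f, ← hrep g]
    exact h
  let l : E → F := fun e => ⟨D.face Set.univ (p e), (e, true), rfl⟩
  let r : E → F := fun e => ⟨D.face Set.univ (q e), (e, false), rfl⟩
  have hwind : ∀ z ∈ cycleSpace D.src D.tgt, ∀ f : F, ∀ x ∉ D.body Set.univ,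
      D.face Set.univ x = f → D.wind (side (rep f)) z = D.wind x z := by
    intro z hz f x hx hxf
    refine D.wind_const (A := Set.univ) ⟨hz, by simp⟩ (D.isPreconnected_face Set.univ x)
      (D.face_disjoint_body _ _) ?_ (D.mem_face hx)
    rw [hxf, ← hrep f]
    exact D.mem_face (hside _)
  have hcyc : ∀ φ : F → ℚ, ∃ z ∈ cycleSpace D.src D.tgt, ∃ c, ∀ f,
      D.wind (side (rep f)) z = φ f + c := by
    intro φ
    obtain ⟨z, hz, c, hc⟩ := D.exists_cycle_of_faces (A := Set.univ) hrepu hrepi φ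
    exact ⟨z, hz.1, c, hc⟩
  have hdiff : ∀ z ∈ cycleSpace D.src D.tgt, ∀ e,
      s e * z e = D.wind (side (rep (l e))) z - D.wind (side (rep (r e))) z := by
    intro z hz e
    rw [← hsz e z hz, hwind z hz (l e) (p e) (hpu e) rfl, hwind z hz (r e) (q e) (hqu e) rfl]
  refine ⟨F, hF, ⟨⟨l, r, s, hs, fun z hz =>
    ⟨fun f => D.wind (side (rep f)) z, hdiff z hz⟩, fun φ => ?_, fun φ hφ f g => ?_,
    fun v φ hφ e e' he he' => ?_⟩⟩⟩
  · obtain ⟨z, hz, c, hc⟩ := hcyc φ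
    refine ⟨z, hz, fun e => ?_⟩
    rw [hdiff z hz, hc, hc]
    ring
  · obtain ⟨z, hz, c, hc⟩ := hcyc φ
    have hz0 : z = 0 := by
      ext e
      have := hdiff z hz e
      rw [hc, hc, hφ e, sub_self] at this
      exact (mul_eq_zero.1 this).resolve_left (hs e)
    have h1 := hc f
    have h2 := hc g
    rw [hz0, map_zero] at h1 h2
    linarith
  -- a cycle that avoids the edges at `v` has the same winding number on all faces around `v`
  · obtain ⟨z, hz, c, hc⟩ := hcyc φ
    have hzA : z ∈ cyclesIn D.src D.tgt {f | D.src f ≠ v ∧ D.tgt f ≠ v} := by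
      refine ⟨hz, fun f hf => ?_⟩
      have hf' : D.src f = v ∨ D.tgt f = v := by
        by_contra! h
        exact hf h
      have := hdiff z hz f
      rw [hc, hc, hφ f hf', add_sub_add_right_eq_sub, sub_self] at this
      exact (mul_eq_zero.1 this).resolve_left (hs f)
    have h1 := D.wind_const hzA (D.isPreconnected_face _ _) (D.face_disjoint_body _ _)
      (D.mem_face_pt he (hp e)) (D.mem_face_pt he' (hp e'))
    have h2 := hwind z hz (l e) (p e) (hpu e) rfl
    have h3 := hwind z hz (l e') (p e') (hpu e') rfl
    have h4 := hc (l e)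
    have h5 := hc (l e')
    linarith

end Topology

/-! ### Orientations of trees and cotrees -/

section LinearAlgebra

/-- Hall's theorem for an injective matrix: distinct columns have nonzero entries in
distinct rows. -/
theorem exists_injective_of_injective {I J : Type*} [Finite I] [Finite J]
    {L : (I → ℚ) →ₗ[ℚ] (J → ℚ)} (hL : Function.Injective L) [DecidableEq I] :
    ∃ σ : I → J, Function.Injective σ ∧ ∀ i, L (Pi.single i 1) (σ i) ≠ 0 := by
  classical
  have := Fintype.ofFinite I
  have := Fintype.ofFinite J
  obtain ⟨σ, hσ, hσ'⟩ := (Finset.all_card_le_biUnion_card_iff_exists_injective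
    (fun i : I => Finset.univ.filter fun j => L (Pi.single i 1) j ≠ 0)).1 (by
      intro S
      -- vectors supported on `S` are mapped to vectors supported on the neighbourhood of `S`
      set N := S.biUnion fun i : I => Finset.univ.filter fun j => L (Pi.single i 1) j ≠ 0 with hN
      let ext : (S → ℚ) →ₗ[ℚ] (I → ℚ) := Function.ExtendByZero.linearMap ℚ (Subtype.val : S → I)
      let M : (S → ℚ) →ₗ[ℚ] (N → ℚ) := LinearMap.funLeft ℚ ℚ (Subtype.val : N → J) ∘ₗ L ∘ₗ ext
      have hM : Function.Injective M := by
        rw [← LinearMap.ker_eq_bot, LinearMap.ker_eq_bot']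
        intro x hx
        have hLx : L (ext x) = 0 := by
          ext j
          by_cases hj : j ∈ N
          · exact congrFun hx ⟨j, hj⟩
          · have h0 : ∀ i ∈ S, L (Pi.single i 1) j = 0 := by
              intro i hi
              by_contra h
              exact hj (Finset.mem_biUnion.2 ⟨i, hi, by simp [h]⟩)
            rw [LinearMap.pi_apply_eq_sum_univ L (ext x)]
            simp only [Finset.sum_apply, Pi.smul_apply, smul_eq_mul, Pi.zero_apply]
            refine Finset.sum_eq_zero fun i _ => ?_
            have hsingle : (fun k => if i = k then (1 : ℚ) else 0) = Pi.single i 1 := by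
              ext k
              simp [Pi.single_apply, eq_comm]
            rw [hsingle]
            by_cases hi : i ∈ S
            · rw [h0 i hi, mul_zero]
            · have : ext x i = 0 := by
                simp only [ext, Function.ExtendByZero.linearMap_apply]
                exact Function.extend_apply' _ _ _ (by rintro ⟨a, rfl⟩; exact hi a.2)
              rw [this, zero_mul]
        have h1 : ext x = 0 := hL (by rw [hLx, map_zero])
        ext i
        have := congrFun h1 i
        simp only [ext, Function.ExtendByZero.linearMap_apply] at this
        rwa [Subtype.val_injective.extend_apply] at this
      have := LinearMap.finrank_le_finrank_of_injective hM
      simpa using this)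
  exact ⟨σ, hσ, fun i => by simpa using hσ' i⟩

/-- If no nonzero vector in `ℚ ^ J` is orthogonal to the image of `ℚ ^ I`, then `|J| ≤ |I|`. -/
theorem card_le_card_of_orthogonal {I J : Type*} [Fintype I] [Fintype J]
    (L : (I → ℚ) →ₗ[ℚ] (J → ℚ))
    (h : ∀ N : J → ℚ, (∀ x, ∑ j, N j * L x j = 0) → N = 0) : Fintype.card J ≤ Fintype.card I := by
  classical
  have hs : Function.Surjective L := by
    rw [← LinearMap.range_eq_top]
    by_contra hne
    obtain ⟨f, hf, hle⟩ := Submodule.exists_le_ker_of_lt_top _ (lt_top_iff_ne_top.2 hne)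
    have hfs : ∀ y : J → ℚ, f y = ∑ j, f (Pi.single j 1) * y j := f.apply_eq_sum_single
    have h0 := h (fun j => f (Pi.single j 1)) (fun x => by
      rw [← hfs]
      exact hle ⟨x, rfl⟩)
    apply hf
    refine LinearMap.ext fun y => ?_
    rw [hfs]
    refine Finset.sum_eq_zero fun j _ => ?_
    have hj : f (Pi.single j 1) = 0 := congrFun h0 j
    rw [hj, zero_mul]
  simpa using LinearMap.finrank_le_finrank_of_surjective hs

end LinearAlgebra

section Orientation

/-- In a connected multigraph with fewer edges than nodes (a tree) every edge can be assigned to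
one of its ends, so that every node but the root gets exactly one edge, and the root none. -/
theorem exists_tree_orientation {N J : Type*} [Fintype N] [Fintype J] [DecidableEq N] (a b : J → N)
    (r : N)
    (hconn : ∀ φ : N → ℚ, (∀ j, φ (a j) = φ (b j)) → φ r = 0 → φ = 0)
    (hcard : Fintype.card J + 1 ≤ Fintype.card N) :
    ∃ p q : J → ℝ, (∀ j, 0 ≤ p j) ∧ (∀ j, 0 ≤ q j) ∧ (∀ j, p j + q j = 1) ∧
      ∀ n, ∑ j, ((if a j = n then p j else 0) + (if b j = n then q j else 0)) =
        if n = r then 0 else 1 := by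
  classical
  let I := {n : N // n ≠ r}
  let ext : (I → ℚ) →ₗ[ℚ] (N → ℚ) := Function.ExtendByZero.linearMap ℚ (Subtype.val : I → N)
  have hext : ∀ x : I → ℚ, ∀ i : I, ext x i = x i := by
    intro x i
    simp only [ext, Function.ExtendByZero.linearMap_apply]
    exact Subtype.val_injective.extend_apply _ _ _
  have hextr : ∀ x : I → ℚ, ext x r = 0 := by
    intro x
    simp only [ext, Function.ExtendByZero.linearMap_apply]
    exact Function.extend_apply' _ _ _ (by rintro ⟨i, hi⟩; exact i.2 hi)
  let L : (I → ℚ) →ₗ[ℚ] (J → ℚ) := LinearMap.funLeft ℚ ℚ a ∘ₗ ext - LinearMap.funLeft ℚ ℚ b ∘ₗ ext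
  have hLapp : ∀ x j, L x j = ext x (a j) - ext x (b j) := fun x j => rfl
  have hL : Function.Injective L := by
    rw [← LinearMap.ker_eq_bot, LinearMap.ker_eq_bot']
    intro x hx
    have h0 := hconn (ext x) (fun j => by
      have := congrFun hx j
      rw [hLapp] at this
      exact sub_eq_zero.1 this) (hextr x)
    ext i
    rw [← hext x i, h0]
    rfl
  obtain ⟨σ, hσ, hσL⟩ := exists_injective_of_injective hL
  have hσend : ∀ i : I, a (σ i) = i ∨ b (σ i) = i := by
    intro i
    by_contra! h
    apply hσL i
    have hz : ∀ n : N, n ≠ i → ext (Pi.single i 1) n = 0 := by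
      intro n hn
      by_cases hnr : n = r
      · rw [hnr, hextr]
      · rw [hext _ ⟨n, hnr⟩, Pi.single_apply, if_neg]
        intro h
        exact hn (congrArg Subtype.val h)
    rw [hLapp, hz _ h.1, hz _ h.2, sub_zero]
  have hbij : Function.Bijective σ := by
    refine (Fintype.bijective_iff_injective_and_card σ).2 ⟨hσ, le_antisymm
      (Fintype.card_le_of_injective σ hσ) ?_⟩
    have : Fintype.card I = Fintype.card N - 1 := by
      simp [I, Fintype.card_subtype_compl]
    omega
  let τ := (Equiv.ofBijective σ hbij).symm
  have hστ : ∀ j, σ (τ j) = j := fun j => (Equiv.ofBijective σ hbij).apply_symm_apply j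
  have hτσ : ∀ i, τ (σ i) = i := fun i => (Equiv.ofBijective σ hbij).symm_apply_apply i
  refine ⟨fun j => if a j = τ j then 1 else 0, fun j => if a j = τ j then 0 else 1,
    fun j => by dsimp only; split_ifs <;> norm_num, fun j => by dsimp only; split_ifs <;> norm_num,
    fun j => by dsimp only; split_ifs <;> norm_num, fun n => ?_⟩
  have hterm : ∀ j, ((if a j = n then (if a j = τ j then (1 : ℝ) else 0) else 0) +
      (if b j = n then (if a j = τ j then (0 : ℝ) else 1) else 0)) =
      if (τ j : N) = n then 1 else 0 := by
    intro j
    have hj := hσend (τ j)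
    rw [hστ] at hj
    by_cases h1 : a j = τ j
    · simp [h1]
    · have h2 := hj.resolve_left h1
      simp only [h1, if_false, ite_self, zero_add, h2]
  simp only [hterm]
  by_cases hn : n = r
  · rw [if_pos hn]
    refine Finset.sum_eq_zero fun j _ => if_neg ?_
    intro h
    exact (τ j).2 (h.trans hn)
  · rw [if_neg hn, Finset.sum_eq_single (σ ⟨n, hn⟩)]
    · rw [hτσ, if_pos rfl]
    · intro j _ hj
      rw [if_neg]
      intro h
      apply hj
      rw [← hστ j]
      congr 1
      exact Subtype.ext h
    · simp

end Orientation

namespace DualGraph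

variable {V E F : Type*} [Fintype E] {src tgt : E → V} (D : DualGraph src tgt F)

/-- The cycle with a given potential on the faces. Adding a constant to the potential does not
change it. -/
def cycleMap : (F → ℚ) →ₗ[ℚ] (E → ℚ) where
  toFun φ e := (φ (D.left e) - φ (D.right e)) / D.scale e
  map_add' := by intro x y; ext e; simp only [Pi.add_apply]; ring
  map_smul' := by intro c x; ext e; simp only [Pi.smul_apply, smul_eq_mul, RingHom.id_apply]; ring

theorem cycleMap_apply (φ : F → ℚ) (e : E) :
    D.cycleMap φ e = (φ (D.left e) - φ (D.right e)) / D.scale e := rfl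

theorem cycleMap_mem (φ : F → ℚ) : D.cycleMap φ ∈ cycleSpace src tgt := by
  obtain ⟨z, hz, h⟩ := D.exists_cycle φ
  convert hz using 1
  ext e
  rw [cycleMap_apply, ← h e, mul_div_cancel_left₀ _ (D.scale_ne_zero e)]

theorem exists_cycleMap_eq {z : E → ℚ} (hz : z ∈ cycleSpace src tgt) : ∃ φ, D.cycleMap φ = z := by
  obtain ⟨φ, h⟩ := D.exists_potential z hz
  refine ⟨φ, funext fun e => ?_⟩
  rw [cycleMap_apply, ← h e, mul_div_cancel_left₀ _ (D.scale_ne_zero e)]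

theorem cycleMap_eq_zero_iff {φ : F → ℚ} {e : E} :
    D.cycleMap φ e = 0 ↔ φ (D.left e) = φ (D.right e) := by
  rw [cycleMap_apply, div_eq_zero_iff, or_iff_left (D.scale_ne_zero e), sub_eq_zero]

/-- The coboundary map, from functions on the vertices to functions on the edges. -/
def coboundary (src tgt : E → V) : (V → ℚ) →ₗ[ℚ] (E → ℚ) :=
  LinearMap.funLeft ℚ ℚ tgt - LinearMap.funLeft ℚ ℚ src

omit [Fintype E] in
theorem coboundary_apply (g : V → ℚ) (e : E) : coboundary src tgt g e = g (tgt e) - g (src e) := rfl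

/-- One half of Euler's formula, for a set `A` of edges with ends in `U` such that all faces
outside `S` are joined without crossing `A`. The vectors on `A` are spanned by the coboundaries
from `U` without one vertex and the cycles with potential supported on `S`: a vector on `A`
orthogonal to the former is a cycle, its potential is constant outside `S`, and so it cannot be
orthogonal to the latter as well. -/
theorem card_le_of_region [Fintype V] [Fintype F] (A : Finset E) (S : Finset F) (U : Finset V)
    (hU : U.Nonempty) (hAU : ∀ e ∈ A, src e ∈ U ∧ tgt e ∈ U)
    (hS : ∀ φ : F → ℚ, (∀ e ∉ A, φ (D.left e) = φ (D.right e)) → ∃ c, ∀ f ∉ S, φ f = c) :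
    A.card + 1 ≤ S.card + U.card := by
  classical
  obtain ⟨u, hu⟩ := hU
  let extS : (S → ℚ) →ₗ[ℚ] (F → ℚ) := Function.ExtendByZero.linearMap ℚ (Subtype.val : S → F)
  let extU : (↥(U.erase u) → ℚ) →ₗ[ℚ] (V → ℚ) :=
    Function.ExtendByZero.linearMap ℚ (Subtype.val : ↥(U.erase u) → V)
  let L : (S ⊕ ↥(U.erase u) → ℚ) →ₗ[ℚ] (A → ℚ) :=
    LinearMap.funLeft ℚ ℚ (Subtype.val : A → E) ∘ₗ
      (D.cycleMap ∘ₗ extS ∘ₗ LinearMap.funLeft ℚ ℚ Sum.inl +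
        coboundary src tgt ∘ₗ extU ∘ₗ LinearMap.funLeft ℚ ℚ Sum.inr)
  have hL1 : ∀ φ : F → ℚ, (∀ f ∉ S, φ f = 0) → ∃ x, ∀ a : A, L x a = D.cycleMap φ a := by
    intro φ hφ
    refine ⟨Sum.elim (fun f => φ f) 0, fun a => ?_⟩
    have h1 : extS (fun f : S => φ f) = φ := by
      ext f
      simp only [extS, Function.ExtendByZero.linearMap_apply]
      by_cases hf : f ∈ S
      · exact Subtype.val_injective.extend_apply (fun f : S => φ f) 0 ⟨f, hf⟩
      · rw [Function.extend_apply' _ _ _ (by rintro ⟨x, rfl⟩; exact hf x.2), hφ f hf]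
        rfl
    have h2 : extU (0 : ↥(U.erase u) → ℚ) = 0 := map_zero _
    change D.cycleMap (extS (fun f : S => φ f)) a + coboundary src tgt (extU 0) a = _
    rw [h1, h2, map_zero]
    simp
  have hL2 : ∀ g : V → ℚ, (∀ v ∉ U.erase u, g v = 0) → ∃ x, ∀ a : A, L x a =
      g (tgt a) - g (src a) := by
    intro g hg
    refine ⟨Sum.elim 0 (fun v => g v), fun a => ?_⟩
    have h1 : extU (fun v : ↥(U.erase u) => g v) = g := by
      ext f
      simp only [extU, Function.ExtendByZero.linearMap_apply]
      by_cases hf : f ∈ U.erase u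
      · exact Subtype.val_injective.extend_apply (fun v : ↥(U.erase u) => g v) 0 ⟨f, hf⟩
      · rw [Function.extend_apply' _ _ _ (by rintro ⟨x, rfl⟩; exact hf x.2), hg f hf]
        rfl
    have h2 : extS (0 : S → ℚ) = 0 := map_zero _
    change D.cycleMap (extS 0) a + coboundary src tgt (extU (fun v : ↥(U.erase u) => g v)) a = _
    rw [h1, h2, map_zero]
    simp [coboundary_apply]
  have hcard := card_le_card_of_orthogonal L (by
    intro N hN
    -- extend `N` by zero
    let z : E → ℚ := fun e => if h : e ∈ A then N ⟨e, h⟩ else 0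
    have hzA : ∀ e ∉ A, z e = 0 := fun e he => dif_neg he
    have hzN : ∀ a : A, z a = N a := fun a => dif_pos a.2
    have hsum : ∀ y : E → ℚ, ∑ e, z e * y e = ∑ a : A, N a * y a := by
      intro y
      rw [← Finset.sum_subset (Finset.subset_univ A) (fun e _ he => by rw [hzA e he, zero_mul]),
        ← Finset.sum_coe_sort A]
      exact Finset.sum_congr rfl fun a _ => by rw [hzN]
    have hz : z ∈ cycleSpace src tgt := by
      intro g
      obtain ⟨x, hx⟩ := hL2 (fun v => if v ∈ U then g v - g u else 0) (by
        intro v hv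
        by_cases hvU : v ∈ U
        · have : v = u := by
            by_contra h
            exact hv (Finset.mem_erase.2 ⟨h, hvU⟩)
          simp [this]
        · simp [hvU])
      have h1 := hN x
      rw [hsum, ← h1]
      refine Finset.sum_congr rfl fun a _ => ?_
      rw [hx a]
      have h2 := hAU a a.2
      simp only [h2.1, h2.2, if_true]
      ring
    obtain ⟨φ, hφ⟩ := D.exists_cycleMap_eq hz
    obtain ⟨c, hc⟩ := hS φ (by
      intro e he
      rw [← D.cycleMap_eq_zero_iff, hφ, hzA e he])
    obtain ⟨x, hx⟩ := hL1 (fun f => φ f - c) (fun f hf => by rw [hc f hf, sub_self])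
    have h1 := hN x
    have h2 : ∀ a : A, L x a = N a := by
      intro a
      rw [hx a, ← hzN a, ← hφ, cycleMap_apply, cycleMap_apply]
      ring
    simp only [h2] at h1
    ext a
    have h3 := (Finset.sum_eq_zero_iff_of_nonneg (fun a _ => mul_self_nonneg (N a))).1 h1 a
      (Finset.mem_univ a)
    exact mul_self_eq_zero.1 h3)
  simp only [Fintype.card_coe, Fintype.card_sum, Finset.card_erase_of_mem hu] at hcard
  have : 0 < U.card := Finset.card_pos.2 ⟨u, hu⟩
  omega

/-- The edges outside a spanning tree `T` form a spanning tree of the dual graph, and can therefore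
be assigned to the faces other than a root face. -/
theorem exists_cotree_orientation [Fintype F] [DecidableEq F] (T : Set E)
    (hTconn : ∀ g : V → ℚ, (∀ e ∈ T, g (src e) = g (tgt e)) → ∀ u v, g u = g v)
    (hTacyc : ∀ z ∈ cyclesIn src tgt T, z = 0) (r : F) :
    ∃ p q : E → ℝ, (∀ e, 0 ≤ p e) ∧ (∀ e, 0 ≤ q e) ∧
      (∀ e ∈ T, p e + q e = 0) ∧ (∀ e ∉ T, p e + q e = 1) ∧
      ∀ f, ∑ e, ((if D.left e = f then p e else 0) + (if D.right e = f then q e else 0)) =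
        if f = r then 0 else 1 := by
  classical
  let J := {e : E // e ∉ T}
  obtain ⟨p, q, hp, hq, hpq, hsum⟩ := exists_tree_orientation (fun j : J => D.left j)
    (fun j : J => D.right j) r (by
      intro φ hφ hr
      have h0 := hTacyc (D.cycleMap φ) ⟨D.cycleMap_mem φ, fun e he =>
        D.cycleMap_eq_zero_iff.2 (hφ ⟨e, he⟩)⟩
      have hconst := D.connected φ fun e => D.cycleMap_eq_zero_iff.1 (congrFun h0 e)
      ext f
      rw [hconst f r, hr]
      rfl) (by
      let I := {f : F // f ≠ r}
      let ext : (I → ℚ) →ₗ[ℚ] (F → ℚ) := Function.ExtendByZero.linearMap ℚ (Subtype.val : I → F)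
      have hcard := card_le_card_of_orthogonal
        (LinearMap.funLeft ℚ ℚ (Subtype.val : J → E) ∘ₗ D.cycleMap ∘ₗ ext) (by
          intro N hN
          let y : E → ℚ := fun e => if h : e ∉ T then N ⟨e, h⟩ else 0
          have hyN : ∀ j : J, y j = N j := fun j => dif_pos j.2
          have hyT : ∀ e ∈ T, y e = 0 := fun e he => dif_neg (not_not.2 he)
          have hsum : ∀ z : E → ℚ, ∑ e, z e * y e = ∑ j : J, N j * z j := by
            intro z
            rw [← Finset.sum_subset (Finset.subset_univ (Finset.univ.filter fun e => e ∉ T))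
              (fun e _ he => by
                rw [hyT e (by simpa using he), mul_zero]),
              Finset.sum_subtype (p := fun e => e ∉ T) _ (by simp)]
            exact Finset.sum_congr rfl fun j _ => by rw [hyN, mul_comm]
          obtain ⟨g, hg⟩ := _root_.exists_potential (src := src) (tgt := tgt) (A := Set.univ)
              (N := y) (by
            rintro z ⟨hz, -⟩
            obtain ⟨φ, rfl⟩ := D.exists_cycleMap_eq hz
            have h1 := hN (fun i => φ i - φ r)
            rw [hsum, ← h1]
            refine Finset.sum_congr rfl fun j _ => ?_
            have h2 : ext (fun i : I => φ i - φ r) = fun f => φ f - φ r := by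
              ext f
              simp only [ext, Function.ExtendByZero.linearMap_apply]
              by_cases hf : f = r
              · rw [Function.extend_apply' _ _ _ (by rintro ⟨i, hi⟩; exact i.2 (hi.trans hf)), hf,
                  sub_self]
                rfl
              · exact Subtype.val_injective.extend_apply (fun i : I => φ i - φ r) 0 ⟨f, hf⟩
            change _ = N j * D.cycleMap (ext (fun i : I => φ i - φ r)) j
            rw [h2, cycleMap_apply, cycleMap_apply]
            ring)
          have hconst := hTconn g (by
            intro e he
            have := hg e trivial
            rw [hyT e he] at this
            linarith)
          ext j
          rw [← hyN j, hg j trivial, hconst (tgt j) (src j), sub_self]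
          rfl)
      have h1 : Fintype.card I = Fintype.card F - 1 := by
        simp [I, Fintype.card_subtype_compl]
      have h2 : 0 < Fintype.card F := Fintype.card_pos_iff.2 ⟨r⟩
      rw [h1] at hcard
      have h3 : Fintype.card J = Fintype.card {e : E // e ∉ T} := rfl
      omega)
  refine ⟨fun e => if h : e ∉ T then p ⟨e, h⟩ else 0, fun e => if h : e ∉ T then q ⟨e, h⟩ else 0,
    ?_, ?_, ?_, ?_, ?_⟩
  · intro e
    dsimp only
    split_ifs <;> [exact le_rfl; exact hp _]
  · intro e
    dsimp only
    split_ifs <;> [exact le_rfl; exact hq _]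
  · intro e he
    simp [he]
  · intro e he
    simp [he, hpq]
  · intro f
    rw [← hsum f, ← Finset.sum_subset (Finset.subset_univ (Finset.univ.filter fun e => e ∉ T))
      (fun e _ he => by
        have : e ∈ T := by simpa using he
        simp [this]),
      Finset.sum_subtype (p := fun e => e ∉ T) _ (by simp)]
    refine Finset.sum_congr rfl fun j _ => ?_
    have hj := j.2
    simp [hj]

end DualGraph

/-! ### The edge bound and Williams' inequality -/

namespace DualGraph

section EdgeBound
variable {V E : Type*} [Fintype E] {src tgt : E → V}

/-- A nonzero cycle of a simple graph has at least three edges. -/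
theorem three_le_card_support (hne : ∀ e, src e ≠ tgt e)
    (hsimple : ∀ e f, s(src e, tgt e) = s(src f, tgt f) → e = f) {z : E → ℚ}
    (hz : z ∈ cycleSpace src tgt) (hz0 : z ≠ 0) :
    3 ≤ (Finset.univ.filter fun e => z e ≠ 0).card := by
  classical
  obtain ⟨e, he⟩ := Function.ne_iff.1 hz0
  -- at each end of `e` there is another edge of the support
  have key : ∀ v, src e = v ∨ tgt e = v → ∃ f, f ≠ e ∧ z f ≠ 0 ∧ (src f = v ∨ tgt f = v) := by
    intro v hv
    by_contra! hcon
    have h1 := hz (fun w => if w = v then 1 else 0)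
    rw [Finset.sum_eq_single e] at h1
    · have : ((if tgt e = v then (1 : ℚ) else 0) - (if src e = v then 1 else 0)) ≠ 0 := by
        rcases hv with rfl | rfl
        · simp [(hne e).symm]
        · simp [hne e]
      exact (mul_ne_zero he this) h1
    · intro f _ hfe
      by_cases hf : z f = 0
      · rw [hf, zero_mul]
      · have h2 := hcon f hfe hf
        simp [h2.1, h2.2]
    · simp
  obtain ⟨f, hfe, hf, hfv⟩ := key (src e) (Or.inl rfl)
  obtain ⟨g, hge, hg, hgv⟩ := key (tgt e) (Or.inr rfl)
  have hfg : f ≠ g := by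
    rintro rfl
    apply hfe
    apply hsimple
    rw [Sym2.eq_iff]
    have := hne e
    rcases hfv with h1 | h1 <;> rcases hgv with h2 | h2
    · exact absurd (h1.symm.trans h2) this
    · exact Or.inl ⟨h1, h2⟩
    · exact Or.inr ⟨h2, h1⟩
    · exact absurd (h1.symm.trans h2) this
  have hsub : ({e, f, g} : Finset E) ⊆ Finset.univ.filter fun e => z e ≠ 0 := by
    intro x hx
    simp only [Finset.mem_insert, Finset.mem_singleton] at hx
    simp only [Finset.mem_filter, Finset.mem_univ, true_and]
    rcases hx with rfl | rfl | rfl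
    · exact he
    · exact hf
    · exact hg
  have hcard : ({e, f, g} : Finset E).card = 3 :=
    Finset.card_eq_three.2 ⟨e, f, g, hfe.symm, hge.symm, hfg, rfl⟩
  rw [← hcard]
  exact Finset.card_le_card hsub

/-- A simple graph with a dual graph has at most `3 |V|` edges: every face is bounded by at least
three edges, and Euler's formula applies. -/
theorem card_edges_le [Fintype V] {F : Type*} [Fintype F] (D : DualGraph src tgt F)
    (hne : ∀ e, src e ≠ tgt e)
    (hsimple : ∀ e f, s(src e, tgt e) = s(src f, tgt f) → e = f) :
    Fintype.card E ≤ 3 * Fintype.card V := by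
  classical
  rcases isEmpty_or_nonempty E with hE | ⟨⟨e₀⟩⟩
  · simp
  have hV : (Finset.univ : Finset V).Nonempty := ⟨src e₀, Finset.mem_univ _⟩
  have heuler := D.card_le_of_region Finset.univ Finset.univ Finset.univ hV (by simp)
    (fun φ _ => ⟨0, by simp⟩)
  simp only [Finset.card_univ] at heuler
  by_cases hdeg : ∃ f, D.cycleMap (Pi.single f 1) = 0
  · -- a face that meets no other face is the only one
    obtain ⟨f, hf⟩ := hdeg
    have hF : Fintype.card F ≤ 1 := by
      rw [Fintype.card_le_one_iff_subsingleton]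
      have hconst := D.connected (Pi.single f 1) fun e => D.cycleMap_eq_zero_iff.1 (congrFun hf e)
      have : ∀ g, g = f := by
        intro g
        by_contra h
        have := hconst g f
        simp [h] at this
      exact ⟨fun a b => (this a).trans (this b).symm⟩
    have : 0 < Fintype.card V := Fintype.card_pos_iff.2 ⟨src e₀⟩
    omega
  · push Not at hdeg
    have h3 : ∀ f : F, 3 ≤ (Finset.univ.filter fun e => D.cycleMap (Pi.single f 1) e ≠ 0).card :=
      fun f => three_le_card_support hne hsimple (D.cycleMap_mem _) (hdeg f)
    have h4 : Fintype.card F * 3 ≤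
        ∑ f : F, (Finset.univ.filter fun e => D.cycleMap (Pi.single f 1) e ≠ 0).card := by
      have := Finset.card_nsmul_le_sum (Finset.univ : Finset F)
        (fun f => (Finset.univ.filter fun e => D.cycleMap (Pi.single f 1) e ≠ 0).card) 3
        (fun f _ => h3 f)
      simpa using this
    have h5 : ∑ f : F, (Finset.univ.filter fun e => D.cycleMap (Pi.single f 1) e ≠ 0).card ≤
        Fintype.card E * 2 := by
      simp only [Finset.card_filter]
      rw [Finset.sum_comm]
      have : ∀ e : E, ∑ f : F, (if D.cycleMap (Pi.single f 1) e ≠ 0 then 1 else 0) ≤ 2 := by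
        intro e
        rw [← Finset.card_filter]
        refine (Finset.card_le_card (t := {D.left e, D.right e}) ?_).trans Finset.card_le_two
        intro f hf
        simp only [Finset.mem_filter, Finset.mem_univ, true_and, ne_eq, cycleMap_eq_zero_iff] at hf
        simp only [Finset.mem_insert, Finset.mem_singleton]
        by_contra! h
        apply hf
        simp [h.1.symm, h.2.symm]
      calc _ ≤ ∑ _e : E, 2 := Finset.sum_le_sum fun e _ => this e
        _ = _ := by simp
    omega

end EdgeBound

section Williams
variable {V E F : Type*} [Fintype E] [Fintype V] [Fintype F] [DecidableEq V] [DecidableEq F]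
  {src tgt : E → V}

/-- Soundness of Williams' formulation. Every edge is split among its two ends (`t₁`, `t₂`) and its
two faces (`d₁`, `d₂`); every vertex but `r` and every face but one beside `r` receives one edge in
total. If `r ∈ U`, the edges inside `U` are paid for by the vertices in `U` other than `r`.
Otherwise let `S` be the set of faces that the edges inside `U` separate from the root face, and
`A` the set of edges inside `U` or beside a face in `S`. The faces in `S` and the vertices outside
`U` that are covered by `A` receive all their shares from `A`, and none of them is a root. So
Euler's formula for `A` bounds what is left for the edges inside `U`. -/
theorem sum_inside_le (D : DualGraph src tgt F) {r : V} {e₀ : E} (he₀ : src e₀ = r ∨ tgt e₀ = r)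
    {t₁ t₂ d₁ d₂ : E → ℝ} (ht₁ : ∀ e, 0 ≤ t₁ e) (ht₂ : ∀ e, 0 ≤ t₂ e) (hd₁ : ∀ e, 0 ≤ d₁ e)
    (hd₂ : ∀ e, 0 ≤ d₂ e) (hone : ∀ e, t₁ e + t₂ e + d₁ e + d₂ e = 1)
    (hV : ∀ v, ∑ e, ((if src e = v then t₁ e else 0) + (if tgt e = v then t₂ e else 0)) =
      if v = r then 0 else 1)
    (hF : ∀ f, ∑ e, ((if D.left e = f then d₁ e else 0) + (if D.right e = f then d₂ e else 0)) =
      if f = D.left e₀ then 0 else 1)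
    (U : Finset V) (hU : U.Nonempty) :
    ∑ e with src e ∈ U ∧ tgt e ∈ U, (t₁ e + t₂ e) ≤ (U.card : ℝ) - 1 := by
  classical
  -- the edges assigned to the members of a set `W` of vertices
  have hVsum : ∀ W : Finset V, ∑ e,
      ((if src e ∈ W then t₁ e else 0) + (if tgt e ∈ W then t₂ e else 0)) =
      ∑ v ∈ W, if v = r then 0 else 1 := by
    intro W
    simp only [← hV]
    rw [Finset.sum_comm]
    refine Finset.sum_congr rfl fun e _ => ?_
    rw [Finset.sum_add_distrib, Finset.sum_ite_eq, Finset.sum_ite_eq]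
  have hFsum : ∀ W : Finset F, ∑ e,
      ((if D.left e ∈ W then d₁ e else 0) + (if D.right e ∈ W then d₂ e else 0)) =
      ∑ f ∈ W, if f = D.left e₀ then 0 else 1 := by
    intro W
    simp only [← hF]
    rw [Finset.sum_comm]
    refine Finset.sum_congr rfl fun e _ => ?_
    rw [Finset.sum_add_distrib, Finset.sum_ite_eq, Finset.sum_ite_eq]
  by_cases hr : r ∈ U
  · have h1 := hVsum U
    have h2 : ∑ v ∈ U, (if v = r then (0 : ℝ) else 1) = (U.card : ℝ) - 1 := by
      rw [← Finset.add_sum_erase U _ hr, if_pos rfl, zero_add,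
        Finset.sum_congr rfl (g := fun _ => (1 : ℝ))
            (fun v hv => if_neg (Finset.ne_of_mem_erase hv))]
      simp [Finset.card_erase_of_mem hr, Nat.cast_pred (Finset.card_pos.2 hU)]
    rw [← h2, ← h1, Finset.sum_filter]
    refine Finset.sum_le_sum fun e _ => ?_
    split_ifs with h3 h4 h5 h5 <;> first | exact le_rfl | (exfalso; tauto) | linarith [ht₁ e, ht₂ e]
  -- the faces that can be reached from the root face without crossing an edge inside `U`
  let inU : E → Prop := fun e => src e ∈ U ∧ tgt e ∈ U
  let reach : F → Prop := JoinedBy D.left D.right {e | ¬ inU e} (D.left e₀)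
  have hreach : ∀ e, ¬ inU e → (reach (D.left e) ↔ reach (D.right e)) := by
    intro e he
    have h : JoinedBy D.left D.right {e | ¬ inU e} (D.left e) (D.right e) :=
      Relation.EqvGen.rel _ _ ⟨e, he, rfl, rfl⟩
    exact ⟨fun h' => h'.trans _ _ _ h, fun h' => h'.trans _ _ _ (h.symm _ _)⟩
  let S : Finset F := Finset.univ.filter fun f => ¬ reach f
  let A : Finset E := Finset.univ.filter fun e => inU e ∨ ¬ reach (D.left e) ∨ ¬ reach (D.right e)
  let U' : Finset V := U ∪ (A.image src ∪ A.image tgt)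
  have hmemA : ∀ e, e ∈ A ↔ inU e ∨ ¬ reach (D.left e) ∨ ¬ reach (D.right e) := by
    intro e; simp [A]
  -- around a vertex outside `U` either all edges belong to `A` or none does
  have hstar : ∀ v ∉ U, ∀ e e', (src e = v ∨ tgt e = v) → (src e' = v ∨ tgt e' = v) →
      e ∈ A → e' ∈ A := by
    intro v hv e e' he he' heA
    have hnot : ∀ e, src e = v ∨ tgt e = v → ¬ inU e := by
      rintro e (rfl | rfl) h
      · exact hv h.1
      · exact hv h.2
    have h1 := D.star_connected v (fun f => if reach f then 1 else 0) (by
      intro e he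
      simp only [hreach e (hnot e he)]) e e' he he'
    rw [hmemA] at heA ⊢
    have h2 : ¬ reach (D.left e) := by
      rcases heA with h | h | h
      · exact absurd h (hnot e he)
      · exact h
      · rwa [hreach e (hnot e he)]
    simp only [h2, if_false] at h1
    right; left
    intro h3
    simp [h3] at h1
  have hrU' : r ∉ U' := by
    intro h
    have hex : ∃ e ∈ A, src e = r ∨ tgt e = r := by
      simp only [U', Finset.mem_union, Finset.mem_image] at h
      rcases h with h | ⟨e, he, h⟩ | ⟨e, he, h⟩
      · exact absurd h hr
      · exact ⟨e, he, Or.inl h⟩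
      · exact ⟨e, he, Or.inr h⟩
    obtain ⟨e, he, her⟩ := hex
    have h0 := hstar r hr e e₀ her he₀ he
    have hroot : reach (D.left e₀) := Relation.EqvGen.refl _
    have hnin : ¬ inU e₀ := by
      rintro ⟨h1, h2⟩
      rcases he₀ with h3 | h3
      · exact hr (h3 ▸ h1)
      · exact hr (h3 ▸ h2)
    rw [hmemA, ← hreach e₀ hnin] at h0
    tauto
  have hcard : A.card + 1 ≤ S.card + U'.card := by
    refine D.card_le_of_region A S U' (hU.mono Finset.subset_union_left) ?_ ?_
    · intro e he
      simp only [U', Finset.mem_union, Finset.mem_image]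
      exact ⟨Or.inr (Or.inl ⟨e, he, rfl⟩), Or.inr (Or.inr ⟨e, he, rfl⟩)⟩
    · intro φ hφ
      refine ⟨φ (D.left e₀), fun f hf => ?_⟩
      have hf' : reach f := by
        by_contra h
        exact hf (by simp [S, h])
      -- along the path from the root face to `f` only reachable faces occur
      have key : ∀ {a b}, JoinedBy D.left D.right {e | ¬ inU e} a b →
          (reach a ↔ reach b) ∧ (reach a → φ a = φ b) := by
        intro a b hab
        induction hab with
        | rel x y h =>
          obtain ⟨e, he, rfl, rfl⟩ := h
          refine ⟨hreach e he, fun h' => hφ e ?_⟩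
          rw [hmemA]
          have := (hreach e he).1 h'
          have he' : ¬ inU e := he
          tauto
        | refl x => exact ⟨Iff.rfl, fun _ => rfl⟩
        | symm x y _ ih => exact ⟨ih.1.symm, fun h => (ih.2 (ih.1.2 h)).symm⟩
        | trans x y z _ _ ih1 ih2 =>
          exact ⟨ih1.1.trans ih2.1, fun h => (ih1.2 h).trans (ih2.2 (ih1.1.1 h))⟩
      exact ((key hf').2 (Relation.EqvGen.refl _)).symm
  -- every face in `S` has its dual edge in `A`
  have hdual : (S.card : ℝ) ≤ ∑ e ∈ A, (d₁ e + d₂ e) := by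
    have h1 := hFsum S
    have h2 : ∑ f ∈ S, (if f = D.left e₀ then (0 : ℝ) else 1) = S.card := by
      rw [Finset.sum_congr rfl (g := fun _ => (1 : ℝ))]
      · simp
      · intro f hf
        rw [if_neg]
        rintro rfl
        exact (Finset.mem_filter.1 hf).2 (Relation.EqvGen.refl _)
    rw [← h2, ← h1, ← Finset.sum_subset (Finset.subset_univ A)]
    · refine Finset.sum_le_sum fun e _ => ?_
      split_ifs <;> linarith [hd₁ e, hd₂ e]
    · intro e _ he
      rw [hmemA] at he
      push Not at he
      simp [S, he.2.1, he.2.2]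
  -- every vertex in `U' \ U` has its tree edge in `A` but not inside `U`
  have hprimal : ((U' \ U).card : ℝ) ≤ ∑ e ∈ A with ¬ inU e, (t₁ e + t₂ e) := by
    have h1 := hVsum (U' \ U)
    have h2 : ∑ v ∈ U' \ U, (if v = r then (0 : ℝ) else 1) = (U' \ U).card := by
      rw [Finset.sum_congr rfl (g := fun _ => (1 : ℝ))]
      · simp
      · intro v hv
        rw [if_neg]
        rintro rfl
        exact hrU' (Finset.mem_sdiff.1 hv).1
    have h3 : ∀ v ∈ U' \ U, ∀ e, src e = v ∨ tgt e = v → e ∈ A ∧ ¬ inU e := by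
      intro v hv e he
      obtain ⟨hv1, hv2⟩ := Finset.mem_sdiff.1 hv
      refine ⟨?_, ?_⟩
      · simp only [U', Finset.mem_union, Finset.mem_image] at hv1
        rcases hv1 with h | ⟨e', he', h⟩ | ⟨e', he', h⟩
        · exact absurd h hv2
        · exact hstar v hv2 e' e (Or.inl h) he he'
        · exact hstar v hv2 e' e (Or.inr h) he he'
      · rintro ⟨h4, h5⟩
        rcases he with rfl | rfl
        · exact hv2 h4
        · exact hv2 h5
    rw [← h2, ← h1, ← Finset.sum_subset (Finset.subset_univ (A.filter fun e => ¬ inU e))]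
    · refine Finset.sum_le_sum fun e _ => ?_
      split_ifs <;> linarith [ht₁ e, ht₂ e]
    · intro e _ he
      rw [Finset.mem_filter] at he
      rw [if_neg fun h => he (h3 _ h e (Or.inl rfl)), if_neg fun h => he (h3 _ h e (Or.inr rfl)),
        add_zero]
  have hsplit : ∑ e ∈ A, (t₁ e + t₂ e) =
      ∑ e with src e ∈ U ∧ tgt e ∈ U, (t₁ e + t₂ e) + ∑ e ∈ A with ¬ inU e, (t₁ e + t₂ e) := by
    rw [← Finset.sum_filter_add_sum_filter_not A inU]
    congr 1
    refine Finset.sum_congr ?_ fun _ _ => rfl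
    ext e
    simp only [Finset.mem_filter, hmemA, Finset.mem_univ, true_and]
    exact ⟨fun h => h.2, fun h => ⟨Or.inl h, h⟩⟩
  have htot : ∑ e ∈ A, (t₁ e + t₂ e) + ∑ e ∈ A, (d₁ e + d₂ e) = A.card := by
    rw [← Finset.sum_add_distrib, Finset.sum_congr rfl (g := fun _ => (1 : ℝ))]
    · simp
    · intro e _
      linarith [hone e]
  have hU'card : ((U' \ U).card : ℝ) = U'.card - U.card := by
    rw [Finset.card_sdiff_of_subset Finset.subset_union_left,
      Nat.cast_sub (Finset.card_le_card Finset.subset_union_left)]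
  have hcardR : (A.card : ℝ) + 1 ≤ S.card + U'.card := by exact_mod_cast hcard
  linarith

end Williams

end DualGraph

section Graphs

open SimpleGraph

/-! ### Edmonds' theorem -/

section Greedy
variable {V : Type*} {G : SimpleGraph V} [Fintype G.edgeSet]

open Classical in
/-- The edges of `G` with both ends in `U`. -/
noncomputable def edgesWithin (G : SimpleGraph V) [Fintype G.edgeSet] (U : Finset V) :
    Finset G.edgeSet :=
  Finset.univ.filter fun e => ∀ v ∈ (e : Sym2 V), v ∈ U

theorem mem_edgesWithin {U : Finset V} {e : G.edgeSet} :
    e ∈ edgesWithin G U ↔ ∀ v ∈ (e : Sym2 V), v ∈ U := by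
  simp [edgesWithin]

open Classical in
/-- The edges of `G` that belong to `H`. -/
noncomputable def edgesOf (G H : SimpleGraph V) [Fintype G.edgeSet] : Finset G.edgeSet :=
  Finset.univ.filter fun e => (e : Sym2 V) ∈ H.edgeSet

theorem mem_edgesOf {H : SimpleGraph V} {e : G.edgeSet} :
    e ∈ edgesOf G H ↔ (e : Sym2 V) ∈ H.edgeSet := by
  simp [edgesOf]

/-- If all inequalities for connected sets hold, then the weight of a subgraph is at most the number
of edges of a spanning forest of it. -/
theorem sum_le_card_of_reachable_eq [Finite V] {x : G.edgeSet → ℝ} (h0 : ∀ e, 0 ≤ x e)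
    (hU : ∀ U : Finset V, U.Nonempty → (G.induce (U : Set V)).Connected →
      ∑ e ∈ edgesWithin G U, x e ≤ (U.card : ℝ) - 1) {F H : SimpleGraph V} (hFH : F ≤ H)
    (hHG : H ≤ G)
    (hreach : F.Reachable = H.Reachable) :
    ∑ e ∈ edgesOf G H, x e ≤ (edgesOf G F).card := by
  classical
  have := Fintype.ofFinite V
  have : Fintype F.ConnectedComponent := Fintype.ofFinite _
  let comp : G.edgeSet → F.ConnectedComponent := fun e => F.connectedComponentMk (e : Sym2 V).out.1
  let U : F.ConnectedComponent → Finset V := fun c => Finset.univ.filter fun v => v ∈ c.supp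
  have hUc : ∀ c, ((U c : Finset V) : Set V) = c.supp := by
    intro c; ext v; simp [U]
  have hout : ∀ e : G.edgeSet, (e : Sym2 V).out.1 ∈ (e : Sym2 V) := fun e => Sym2.out_fst_mem _
  have hsame : ∀ e : G.edgeSet, (e : Sym2 V) ∈ H.edgeSet → ∀ v ∈ (e : Sym2 V),
      F.connectedComponentMk v = comp e := by
    intro e he v hv
    rw [ConnectedComponent.eq, hreach]
    by_cases hvo : v = (e : Sym2 V).out.1
    · rw [hvo]
    · have h1 := (Sym2.mem_and_mem_iff hvo).1 ⟨hv, hout e⟩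
      rw [h1, mem_edgeSet] at he
      exact he.reachable
  have hedges : ∀ c : F.ConnectedComponent,
      (U c).card ≤ ((edgesOf G F).filter fun e => comp e = c).card + 1 := by
    intro c
    have h1 := (c.connected_toSimpleGraph).card_vert_le_card_edgeSet_add_one
    have h2 : Nat.card c = (U c).card := by
      change Nat.card c.supp = _
      rw [← hUc c]
      simp
    rw [h2] at h1
    refine h1.trans (Nat.add_le_add_right ?_ 1)
    have hmem : ∀ e ∈ c.toSimpleGraph.edgeSet, Sym2.map Subtype.val e ∈ F.edgeSet ∧
        ∀ v ∈ Sym2.map Subtype.val e, v ∈ c.supp := by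
      intro e
      induction e with | _ a b =>
      intro h
      refine ⟨h, ?_⟩
      intro v hv
      simp only [Sym2.map_mk, Sym2.mem_iff] at hv
      rcases hv with rfl | rfl
      · exact a.2
      · exact b.2
    let f₀ : c.toSimpleGraph.edgeSet → G.edgeSet := fun e => ⟨Sym2.map Subtype.val e.1,
      SimpleGraph.edgeSet_subset_edgeSet.2 (hFH.trans hHG) (hmem e e.2).1⟩
    have hf₀ : ∀ e, f₀ e ∈ (edgesOf G F).filter fun e => comp e = c := by
      intro e
      rw [Finset.mem_filter, mem_edgesOf]
      exact ⟨(hmem e e.2).1, (hmem e e.2).2 _ (hout (f₀ e))⟩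
    have hf : Function.Injective f₀ := by
      intro e e' h
      exact Subtype.ext (Sym2.map.injective Subtype.val_injective (congrArg Subtype.val h))
    have : Fintype c.toSimpleGraph.edgeSet := Fintype.ofFinite _
    rw [Nat.card_eq_fintype_card, ← Finset.card_univ]
    exact Finset.card_le_card_of_injOn f₀ (fun e _ => hf₀ e) hf.injOn
  have hconn : ∀ c, (G.induce ((U c : Finset V) : Set V)).Connected := by
    intro c
    rw [hUc]
    exact (c.connected_toSimpleGraph).mono (fun a b h => (hFH.trans hHG) h)
  have hne : ∀ c, (U c).Nonempty := by
    intro c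
    obtain ⟨v, hv⟩ := c.nonempty_supp
    exact ⟨v, by simpa [U] using hv⟩
  calc ∑ e ∈ edgesOf G H, x e
      = ∑ c, ∑ e ∈ edgesOf G H with comp e = c, x e := (Finset.sum_fiberwise _ _ _).symm
    _ ≤ ∑ c, ∑ e ∈ edgesWithin G (U c), x e := by
        refine Finset.sum_le_sum fun c _ => Finset.sum_le_sum_of_subset_of_nonneg ?_ fun e _ _ => h0 e
        intro e he
        obtain ⟨h1, h2⟩ := Finset.mem_filter.1 he
        rw [mem_edgesWithin]
        intro v hv
        have := hsame e (mem_edgesOf.1 h1) v hv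
        simp only [U, Finset.mem_filter, Finset.mem_univ, true_and, ConnectedComponent.mem_supp_iff]
        rw [this, h2]
    _ ≤ ∑ c, (((edgesOf G F).filter fun e => comp e = c).card : ℝ) := by
        refine Finset.sum_le_sum fun c _ => (hU _ (hne c) (hconn c)).trans ?_
        have : ((U c).card : ℝ) ≤ ((edgesOf G F).filter fun e => comp e = c).card + 1 := by
          exact_mod_cast hedges c
        linarith
    _ = (edgesOf G F).card := by
        rw [← Nat.cast_sum]
        congr 1
        simp only [Finset.card_eq_sum_ones]
        exact Finset.sum_fiberwise _ _ _

/-- Abel summation: if all superlevel sets of `c` have nonnegative `y`-weight, and the total weight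
is zero, then the `c`-weighted sum of `y` is nonnegative. -/
theorem sum_mul_nonneg_of_superlevel {E : Type*} [Fintype E] {c y : E → ℝ} (hy : ∑ e, y e = 0)
    (h : ∀ a : ℝ, 0 ≤ ∑ e with a ≤ c e, y e) : 0 ≤ ∑ e, c e * y e := by
  classical
  obtain ⟨n, hn⟩ : ∃ n, (Finset.univ.image c).card = n := ⟨_, rfl⟩
  induction n using Nat.strong_induction_on generalizing c with
  | _ n ih =>
  rcases isEmpty_or_nonempty E with hE | hE
  · simp
  obtain ⟨e₀, -, he₀⟩ := Finset.exists_min_image (Finset.univ : Finset E) c Finset.univ_nonempty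
  by_cases hall : ∀ e, c e = c e₀
  · simp only [hall, ← Finset.mul_sum, hy, mul_zero, le_refl]
  push Not at hall
  obtain ⟨e', he'⟩ := hall
  obtain ⟨e₁, he₁, hmin⟩ := Finset.exists_min_image (Finset.univ.filter fun e => c e ≠ c e₀) c
    ⟨e', by simpa using he'⟩
  have he₁' : c e₁ ≠ c e₀ := (Finset.mem_filter.1 he₁).2
  have hlt : c e₀ < c e₁ := lt_of_le_of_ne (he₀ e₁ (Finset.mem_univ _)) he₁'.symm
  -- raise the lowest level to the second lowest one
  have hdich : ∀ e, c e = c e₀ ∨ c e₁ ≤ c e := by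
    intro e
    by_cases h : c e = c e₀
    · exact Or.inl h
    · exact Or.inr (hmin e (by simpa using h))
  have hmax : ∀ e, max (c e) (c e₁) = c e + if c e₁ ≤ c e then 0 else c e₁ - c e₀ := by
    intro e
    rcases hdich e with h | h
    · rw [h, if_neg (not_le.2 hlt), max_eq_right hlt.le]
      ring
    · rw [if_pos h, max_eq_left h, add_zero]
  have hcard : (Finset.univ.image fun e => max (c e) (c e₁)).card < n := by
    rw [← hn]
    refine Finset.card_lt_card ?_
    refine (Finset.ssubset_iff_of_subset ?_).2 ⟨c e₀, by simp, ?_⟩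
    · intro r hr
      obtain ⟨e, -, rfl⟩ := Finset.mem_image.1 hr
      rcases max_choice (c e) (c e₁) with h | h <;> rw [h] <;> simp
    · intro hr
      obtain ⟨e, -, he⟩ := Finset.mem_image.1 hr
      have := le_max_right (c e) (c e₁)
      linarith
  have h1 := ih _ hcard (c := fun e => max (c e) (c e₁)) (by
    intro a
    by_cases ha : a ≤ c e₁
    · have : (Finset.univ.filter fun e => a ≤ max (c e) (c e₁)) = Finset.univ :=
        Finset.filter_true_of_mem fun e _ => ha.trans (le_max_right _ _)
      rw [this, hy]
    · have : (Finset.univ.filter fun e => a ≤ max (c e) (c e₁)) =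
        Finset.univ.filter fun e => a ≤ c e := by
        ext e
        simp [ha]
      rw [this]
      exact h a) rfl
  have h2 : ∑ e, (if c e₁ ≤ c e then 0 else c e₁ - c e₀) * y e =
      (c e₁ - c e₀) * (0 - ∑ e with c e₁ ≤ c e, y e) := by
    have h0 : 0 - ∑ e with c e₁ ≤ c e, y e = ∑ e, (y e - if c e₁ ≤ c e then y e else 0) := by
      rw [Finset.sum_sub_distrib, hy, Finset.sum_filter]
    rw [h0, Finset.mul_sum]
    refine Finset.sum_congr rfl fun e _ => ?_
    split_ifs <;> ring
  have h3 : ∑ e, max (c e) (c e₁) * y e = ∑ e, c e * y e +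
      (c e₁ - c e₀) * (0 - ∑ e with c e₁ ≤ c e, y e) := by
    rw [← h2, ← Finset.sum_add_distrib]
    refine Finset.sum_congr rfl fun e _ => ?_
    rw [hmax]; ring
  have h4 := h (c e₁)
  have h5 : 0 ≤ (c e₁ - c e₀) * ∑ e with c e₁ ≤ c e, y e := mul_nonneg (by linarith) h4
  linarith

/-- The subgraph of the edges of weight at least `a`. -/
def superlevel (c : G.edgeSet → ℝ) (a : ℝ) : SimpleGraph V :=
  SimpleGraph.fromEdgeSet {e | ∃ h : e ∈ G.edgeSet, a ≤ c ⟨e, h⟩}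

omit [Fintype G.edgeSet] in
theorem superlevel_anti (c : G.edgeSet → ℝ) {a b : ℝ} (h : a ≤ b) :
    superlevel c b ≤ superlevel c a :=
  SimpleGraph.fromEdgeSet_mono fun _ ⟨h1, h2⟩ => ⟨h1, h.trans h2⟩

omit [Fintype G.edgeSet] in
theorem superlevel_le (c : G.edgeSet → ℝ) (a : ℝ) : superlevel c a ≤ G := by
  intro u v h
  rw [superlevel, SimpleGraph.fromEdgeSet_adj] at h
  exact h.1.1

omit [Fintype G.edgeSet] in
theorem mem_edgeSet_superlevel (c : G.edgeSet → ℝ) (a : ℝ) (e : G.edgeSet) :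
    (e : Sym2 V) ∈ (superlevel c a).edgeSet ↔ a ≤ c e := by
  rw [superlevel, SimpleGraph.edgeSet_fromEdgeSet]
  constructor
  · rintro ⟨⟨_, h⟩, _⟩
    exact h
  · intro h
    exact ⟨⟨e.2, h⟩, G.not_isDiag_of_mem_edgeSet e.2⟩

omit [Fintype G.edgeSet] in
/-- Kruskal's algorithm: a forest that spans every superlevel graph of a finite set of levels. -/
theorem exists_greedy_forest (c : G.edgeSet → ℝ) (S : Finset ℝ) :
    ∃ F : SimpleGraph V, F.IsAcyclic ∧ (∀ b, (∀ a ∈ S, b ≤ a) → F ≤ superlevel c b) ∧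
      ∀ a ∈ S, (F ⊓ superlevel c a).Reachable = (superlevel c a).Reachable := by
  induction S using Finset.induction_on_min with
  | empty => exact ⟨⊥, SimpleGraph.isAcyclic_bot, fun _ _ => bot_le, by simp⟩
  | insert a S ha ih =>
    obtain ⟨F, hF, hle, hreach⟩ := ih
    obtain ⟨F', hFF', hF'le, hF', hF'reach⟩ :=
      SimpleGraph.exists_isAcyclic_reachable_eq_le_of_le_of_isAcyclic
        (hle a fun b hb => (ha b hb).le) hF
    refine ⟨F', hF', ?_, ?_⟩
    · intro b hb
      exact hF'le.trans (superlevel_anti c (hb a (Finset.mem_insert_self a S)))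
    · intro b hb
      rcases Finset.mem_insert.1 hb with rfl | hb
      · rw [inf_eq_left.2 hF'le, hF'reach]
      · ext u v
        refine ⟨fun h => h.mono inf_le_right, fun h => ?_⟩
        rw [← hreach b hb] at h
        exact h.mono (inf_le_inf_right _ hFF')

theorem edgesOf_card_of_isTree [Finite V] {T : SimpleGraph V} (hT : T.IsTree) (hTG : T ≤ G) :
    (edgesOf G T).card + 1 = Nat.card V := by
  rw [← (isTree_iff_connected_and_card.1 hT).2]
  congr 1
  have h1 : (edgesOf G T).card = Nat.card (edgesOf G T) := by simp
  rw [h1]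
  refine Nat.card_congr ⟨fun e => ⟨e.1, mem_edgesOf.1 e.2⟩,
    fun e => ⟨⟨e, edgeSet_subset_edgeSet.2 hTG e.2⟩, mem_edgesOf.2 e.2⟩, fun _ => rfl, fun _ => rfl⟩

omit [Fintype G.edgeSet] in
theorem edgeVector_eq (T : SimpleGraph V) [DecidablePred fun e => e ∈ T.edgeSet] (e : G.edgeSet) :
    edgeVector G T e = if (e : Sym2 V) ∈ T.edgeSet then 1 else 0 := by
  classical
  simp only [edgeVector, Set.indicator_apply]

open Classical in
theorem sum_edgeVector (T : SimpleGraph V) (A : Finset G.edgeSet) :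
    ∑ e ∈ A, edgeVector G T e = ((A ∩ edgesOf G T).card : ℝ) := by
  classical
  have h : A ∩ edgesOf G T = A.filter fun e : G.edgeSet => (e : Sym2 V) ∈ T.edgeSet := by
    ext e
    simp [mem_edgesOf]
  rw [h, Finset.card_filter]
  push_cast
  exact Finset.sum_congr rfl fun e _ => edgeVector_eq T e

/-- Edmonds' description of the spanning tree polytope, with the inequalities for connected vertex
sets only. A point outside the polytope is separated from it by a linear functional, say with
coefficients `c`. By the inequalities the greedy spanning tree for `c` has in every superlevel set
of `c` at least as much weight as the point, so its value under the functional is at least that of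
the point. -/
theorem mem_spanningTreePolytope [Finite V] (hG : G.Connected) {x : G.edgeSet → ℝ}
    (h0 : ∀ e, 0 ≤ x e)
    (hsum : ∑ e, x e = (Nat.card V : ℝ) - 1)
    (hU : ∀ U : Finset V, U.Nonempty → (G.induce (U : Set V)).Connected →
      ∑ e ∈ edgesWithin G U, x e ≤ (U.card : ℝ) - 1) : x ∈ spanningTreePolytope G := by
  classical
  by_contra hx
  have hfin : {x | ∃ T : SimpleGraph V, T ≤ G ∧ T.IsTree ∧ x = edgeVector G T}.Finite := by
    refine (Set.finite_range fun T : SimpleGraph V => edgeVector G T).subset ?_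
    rintro _ ⟨T, -, -, rfl⟩
    exact ⟨T, rfl⟩
  obtain ⟨f, u, hf1, hf2⟩ := geometric_hahn_banach_closed_point (convex_convexHull ℝ _)
    (hfin.isClosed_convexHull ℝ) hx
  let c : G.edgeSet → ℝ := fun e => f (Pi.single e 1)
  have hfc : ∀ y, f y = ∑ e, c e * y e :=
    (f : (G.edgeSet → ℝ) →ₗ[ℝ] ℝ).apply_eq_sum_single
  obtain ⟨m, hm⟩ : ∃ m, ∀ e, m ≤ c e := by
    obtain ⟨m, hm⟩ := (Set.finite_range c).bddBelow
    exact ⟨m, fun e => hm ⟨e, rfl⟩⟩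
  have hGm : superlevel c m = G := by
    refine le_antisymm (superlevel_le c m) ?_
    rw [← edgeSet_subset_edgeSet]
    intro e he
    exact (mem_edgeSet_superlevel c m ⟨e, he⟩).2 (hm _)
  obtain ⟨T, hT, -, hreach⟩ := exists_greedy_forest c (insert m (Finset.univ.image c))
  obtain ⟨T, hTG, hT, hreach⟩ : ∃ T ≤ G, T.IsTree ∧ ∀ a ∈ insert m (Finset.univ.image c),
      (T ⊓ superlevel c a).Reachable = (superlevel c a).Reachable := by
    have hr := hreach m (Finset.mem_insert_self _ _)
    rw [hGm] at hr
    refine ⟨T ⊓ G, inf_le_right,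
      ⟨(connected_iff _).2 ⟨fun u v => ?_, hG.nonempty⟩, hT.anti inf_le_left⟩, fun a ha => ?_⟩
    · rw [hr]
      exact hG.preconnected u v
    · rw [inf_assoc, inf_eq_right.2 (superlevel_le c a)]
      exact hreach a ha
  have hTsum : ∑ e, edgeVector G T e = (Nat.card V : ℝ) - 1 := by
    rw [sum_edgeVector, Finset.univ_inter, ← edgesOf_card_of_isTree hT hTG]
    push_cast
    ring
  have hpos : 0 ≤ ∑ e, c e * (edgeVector G T e - x e) := by
    refine sum_mul_nonneg_of_superlevel (by rw [Finset.sum_sub_distrib, hTsum, hsum, sub_self]) ?_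
    intro a
    by_cases hex : ∃ e, a ≤ c e
    · obtain ⟨e₁, he₁, hmin⟩ := Finset.exists_min_image (Finset.univ.filter fun e => a ≤ c e) c
        (by obtain ⟨e, he⟩ := hex; exact ⟨e, by simpa using he⟩)
      have ha1 : a ≤ c e₁ := (Finset.mem_filter.1 he₁).2
      have hset : (Finset.univ.filter fun e => a ≤ c e) = edgesOf G (superlevel c (c e₁)) := by
        ext e
        rw [mem_edgesOf, mem_edgeSet_superlevel]
        exact ⟨fun h => hmin e h, fun h => by simpa using ha1.trans h⟩
      rw [hset, Finset.sum_sub_distrib, sub_nonneg]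
      refine (sum_le_card_of_reachable_eq h0 hU (inf_le_right : T ⊓ superlevel c (c e₁) ≤ _)
        (superlevel_le c _) (hreach _ (Finset.mem_insert_of_mem (Finset.mem_image_of_mem c
          (Finset.mem_univ _))))).trans ?_
      rw [sum_edgeVector]
      have : edgesOf G (T ⊓ superlevel c (c e₁)) ⊆
          edgesOf G (superlevel c (c e₁)) ∩ edgesOf G T := by
        intro e he
        rw [mem_edgesOf, edgeSet_inf] at he
        rw [Finset.mem_inter, mem_edgesOf, mem_edgesOf]
        exact ⟨he.2, he.1⟩
      exact_mod_cast Finset.card_le_card this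
    · push Not at hex
      rw [Finset.filter_false_of_mem fun e _ => not_le.2 (hex e)]
      simp
  have h1 := hf1 (edgeVector G T) (subset_convexHull ℝ _ ⟨T, hTG, hT, rfl⟩)
  rw [hfc] at h1 hf2
  simp only [mul_sub, Finset.sum_sub_distrib] at hpos
  linarith

end Greedy

/-! ### Calculus of extended formulations -/

namespace HasExtendedFormulation

variable {E E' : Type*} [AddCommGroup E] [Module ℝ E] [AddCommGroup E'] [Module ℝ E']

/-- The additional variables may range over any finite-dimensional space, and the inequalities and
equations may be indexed by arbitrary finite types. -/
theorem of_finite {Y : Type*} [AddCommGroup Y] [Module ℝ Y] [FiniteDimensional ℝ Y]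
    {J L : Type*} [Fintype J] [Fintype L] (A : E →ₗ[ℝ] (J → ℝ)) (B : Y →ₗ[ℝ] (J → ℝ)) (b : J → ℝ)
    (C : E →ₗ[ℝ] (L → ℝ)) (D : Y →ₗ[ℝ] (L → ℝ)) (c : L → ℝ) :
    HasExtendedFormulation {x | ∃ y, A x + B y ≤ b ∧ C x + D y = c} (Fintype.card J) := by
  let eY := (Module.finBasis ℝ Y).equivFun
  let eJ := (Fintype.equivFin J).symm
  let eL := (Fintype.equivFin L).symm
  refine ⟨Module.finrank ℝ Y, Fintype.card L, LinearMap.funLeft ℝ ℝ eJ ∘ₗ A,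
    LinearMap.funLeft ℝ ℝ eJ ∘ₗ B ∘ₗ eY.symm.toLinearMap, b ∘ eJ, LinearMap.funLeft ℝ ℝ eL ∘ₗ C,
    LinearMap.funLeft ℝ ℝ eL ∘ₗ D ∘ₗ eY.symm.toLinearMap, c ∘ eL, ?_⟩
  ext x
  constructor
  · rintro ⟨y, h1, h2⟩
    refine ⟨eY y, ?_, ?_⟩
    · intro j
      have := h1 (eJ j)
      simpa [LinearMap.funLeft_apply] using this
    · ext l
      have := congrFun h2 (eL l)
      simpa [LinearMap.funLeft_apply] using this
  · rintro ⟨y, h1, h2⟩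
    refine ⟨eY.symm y, ?_, ?_⟩
    · intro j
      have := h1 (eJ.symm j)
      simpa [LinearMap.funLeft_apply] using this
    · ext l
      have := congrFun h2 (eL.symm l)
      simpa [LinearMap.funLeft_apply] using this

theorem comap {P : Set E} {m : ℕ} (h : HasExtendedFormulation P m) (f : E' →ₗ[ℝ] E) :
    HasExtendedFormulation (f ⁻¹' P) m := by
  obtain ⟨d, p, A, B, b, C, D, c, rfl⟩ := h
  exact ⟨d, p, A ∘ₗ f, B, b, C ∘ₗ f, D, c, rfl⟩

theorem inter {P Q : Set E} {m n : ℕ} (hP : HasExtendedFormulation P m)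
    (hQ : HasExtendedFormulation Q n) : HasExtendedFormulation (P ∩ Q) (m + n) := by
  obtain ⟨d, p, A, B, b, C, D, c, rfl⟩ := hP
  obtain ⟨d', p', A', B', b', C', D', c', rfl⟩ := hQ
  let sJ := (LinearEquiv.sumArrowLequivProdArrow (Fin m) (Fin n) ℝ ℝ).symm.toLinearMap
  let sL := (LinearEquiv.sumArrowLequivProdArrow (Fin p) (Fin p') ℝ ℝ).symm.toLinearMap
  have h := of_finite (Y := (Fin d → ℝ) × (Fin d' → ℝ)) (sJ ∘ₗ A.prod A') (sJ ∘ₗ B.prodMap B')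
    (Sum.elim b b') (sL ∘ₗ C.prod C') (sL ∘ₗ D.prodMap D') (Sum.elim c c')
  rw [Fintype.card_sum, Fintype.card_fin, Fintype.card_fin] at h
  convert h using 1
  ext x
  constructor
  · rintro ⟨⟨y, h1, h2⟩, ⟨y', h3, h4⟩⟩
    refine ⟨(y, y'), ?_, ?_⟩
    · rintro (j | j)
      · exact h1 j
      · exact h3 j
    · ext (l | l)
      · exact congrFun h2 l
      · exact congrFun h4 l
  · rintro ⟨⟨y, y'⟩, h1, h2⟩
    refine ⟨⟨y, fun j => h1 (Sum.inl j), funext fun l => congrFun h2 (Sum.inl l)⟩,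
      ⟨y', fun j => h1 (Sum.inr j), funext fun l => congrFun h2 (Sum.inr l)⟩⟩

theorem univ : HasExtendedFormulation (Set.univ : Set E) 0 :=
  ⟨0, 0, 0, 0, 0, 0, 0, 0, by ext x; simp⟩

theorem biInter {ι : Type*} (s : Finset ι) {P : ι → Set E} {m : ι → ℕ}
    (h : ∀ i ∈ s, HasExtendedFormulation (P i) (m i)) :
    HasExtendedFormulation {x | ∀ i ∈ s, x ∈ P i} (∑ i ∈ s, m i) := by
  classical
  induction s using Finset.induction_on with
  | empty => simpa using univ
  | insert a s ha ih =>
    rw [Finset.sum_insert ha]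
    have := (h a (Finset.mem_insert_self a s)).inter
      (ih fun i hi => h i (Finset.mem_insert_of_mem hi))
    convert this using 1
    ext x
    simp

theorem iInter {ι : Type*} [Fintype ι] {P : ι → Set E} {m : ι → ℕ}
    (h : ∀ i, HasExtendedFormulation (P i) (m i)) :
    HasExtendedFormulation {x | ∀ i, x ∈ P i} (∑ i, m i) := by
  simpa using biInter Finset.univ (fun i _ => h i)

theorem le (f : E →ₗ[ℝ] ℝ) (b : ℝ) : HasExtendedFormulation {x | f x ≤ b} 1 :=
  ⟨0, 0, LinearMap.pi fun _ => f, 0, fun _ => b, 0, 0, 0, by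
    ext x
    simp [Pi.le_def]⟩

theorem eq (f : E →ₗ[ℝ] ℝ) (b : ℝ) : HasExtendedFormulation {x | f x = b} 0 :=
  ⟨0, 1, 0, 0, 0, LinearMap.pi fun _ => f, 0, fun _ => b, by
    ext x
    simp [funext_iff]⟩

theorem nonneg (f : E →ₗ[ℝ] ℝ) : HasExtendedFormulation {x | 0 ≤ f x} 1 := by
  simpa using le (-f) 0

theorem forall_nonneg {ι : Type*} [Fintype ι] (f : ι → E →ₗ[ℝ] ℝ) :
    HasExtendedFormulation {x | ∀ i, 0 ≤ f i x} (Fintype.card ι) := by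
  simpa using iInter fun i => nonneg (f i)

theorem forall_eq {ι : Type*} [Fintype ι] (f : ι → E →ₗ[ℝ] ℝ) (b : ι → ℝ) :
    HasExtendedFormulation {x | ∀ i, f i x = b i} 0 := by
  simpa using iInter fun i => eq (f i) (b i)

/-- A projection along finitely many coordinates needs no additional inequalities. -/
theorem proj {Y : Type*} [AddCommGroup Y] [Module ℝ Y] [FiniteDimensional ℝ Y] {P : Set (E × Y)}
    {m : ℕ} (h : HasExtendedFormulation P m) :
    HasExtendedFormulation {x | ∃ y, (x, y) ∈ P} m := by
  obtain ⟨d, p, A, B, b, C, D, c, rfl⟩ := h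
  have h := of_finite (Y := Y × (Fin d → ℝ)) (A ∘ₗ LinearMap.inl ℝ E Y)
    ((A ∘ₗ LinearMap.inr ℝ E Y).coprod B) b (C ∘ₗ LinearMap.inl ℝ E Y)
    ((C ∘ₗ LinearMap.inr ℝ E Y).coprod D) c
  rw [Fintype.card_fin] at h
  convert h using 1
  ext x
  have hA : ∀ y, A (x, y) = A (x, 0) + A (0, y) := fun y => by rw [← map_add]; simp
  have hC : ∀ y, C (x, y) = C (x, 0) + C (0, y) := fun y => by rw [← map_add]; simp
  constructor
  · rintro ⟨y, w, h1, h2⟩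
    refine ⟨(y, w), ?_, ?_⟩
    · simpa [hA y, add_assoc] using h1
    · simpa [hC y, add_assoc] using h2
  · rintro ⟨⟨y, w⟩, h1, h2⟩
    refine ⟨y, w, ?_, ?_⟩
    · rw [hA y]; simpa [add_assoc] using h1
    · rw [hC y]; simpa [add_assoc] using h2

theorem convex {P : Set E} {m : ℕ} (h : HasExtendedFormulation P m) : Convex ℝ P := by
  obtain ⟨d, p, A, B, b, C, D, c, rfl⟩ := h
  rintro x ⟨y, h1, h2⟩ x' ⟨y', h3, h4⟩ s t hs ht hst
  refine ⟨s • y + t • y', ?_, ?_⟩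
  · have e : A (s • x + t • x') + B (s • y + t • y') = s • (A x + B y) + t • (A x' + B y') := by
      simp only [map_add, map_smul, smul_add]
      abel
    have eb : b = s • b + t • b := by rw [← add_smul, hst, one_smul]
    rw [e, eb]
    exact add_le_add (smul_le_smul_of_nonneg_left h1 hs) (smul_le_smul_of_nonneg_left h3 ht)
  · have e : C (s • x + t • x') + D (s • y + t • y') = s • (C x + D y) + t • (C x' + D y') := by
      simp only [map_add, map_smul, smul_add]
      abel
    rw [e, h2, h4, ← add_smul, hst, one_smul]

end HasExtendedFormulation

theorem extensionComplexity_le {E : Type*} [AddCommGroup E] [Module ℝ E] {P : Set E} {m n : ℕ}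
    (h : HasExtendedFormulation P m) (hmn : m ≤ n) : extensionComplexity P ≤ (n : ℕ∞) :=
  (iInf₂_le m h).trans (by exact_mod_cast hmn)

/-! ### Planar graphs and Martin's and Williams' formulations -/

/-- A plane drawing becomes an arc system when every edge is oriented in the direction of its arc
and the Euclidean plane is identified with `ℂ`. -/
theorem PlaneDrawing.exists_arcSystem {V : Type*} {G : SimpleGraph V} (D : PlaneDrawing G) :
    ∃ A : ArcSystem V G.edgeSet, ∀ e : G.edgeSet, (e : Sym2 V) = s(A.src e, A.tgt e) := by
  have h : ∀ e : G.edgeSet, ∃ u v, (e : Sym2 V) = s(u, v) ∧ D.arc e 0 = D.point u ∧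
      D.arc e 1 = D.point v := by
    intro e
    obtain ⟨⟨a, b⟩, hab⟩ := Sym2.mk_surjective (e : Sym2 V)
    have h := D.arc_ends e
    rw [← hab] at h
    rcases Sym2.eq_iff.1 (h : s(D.arc e 0, D.arc e 1) = s(D.point a, D.point b)) with
      ⟨h0, h1⟩ | ⟨h0, h1⟩
    · exact ⟨a, b, hab.symm, h0, h1⟩
    · exact ⟨b, a, hab.symm.trans Sym2.eq_swap, h0, h1⟩
  choose src tgt hends h0 h1 using h
  let φ := Complex.orthonormalBasisOneI.repr.symm
  exact ⟨{
    src := src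
    tgt := tgt
    pt := fun v => φ (D.point v)
    arc := fun e t => φ (D.arc e t)
    pt_injective := φ.injective.comp D.point_injective
    arc_continuous := fun e => φ.continuous.comp (D.arc_continuous e)
    arc_injective := fun e => φ.injective.comp (D.arc_injective e)
    arc_zero := fun e => by rw [h0]
    arc_one := fun e => by rw [h1]
    arc_ne_pt := fun e t ht v h => D.arc_ne_point e t ht v (φ.injective h)
    arc_ne_arc := fun e f hef s hs t ht h => D.arc_ne_arc e f hef s hs t ht (φ.injective h) },
    hends⟩

theorem IsPlanar.exists_dualGraph {V : Type*} [Finite V] {G : SimpleGraph V} [Fintype G.edgeSet]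
    (h : IsPlanar G) : ∃ (src tgt : G.edgeSet → V)
        (_ : ∀ e : G.edgeSet, (e : Sym2 V) = s(src e, tgt e))
      (F : Type) (_ : Fintype F), Nonempty (DualGraph src tgt F) := by
  obtain ⟨D⟩ := h
  obtain ⟨A, hA⟩ := D.exists_arcSystem
  obtain ⟨F, hF, hD⟩ := A.exists_dualGraph
  exact ⟨A.src, A.tgt, hA, F, Fintype.ofFinite F, hD⟩

theorem IsPlanar.of_injective {V W : Type*} {G : SimpleGraph V} {H : SimpleGraph W}
    (h : IsPlanar G) (f : H →g G) (hf : Function.Injective f) : IsPlanar H := by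
  obtain ⟨D⟩ := h
  have hinj := Hom.mapEdgeSet.injective f hf
  exact ⟨{
    point := fun w => D.point (f w)
    arc := fun e => D.arc (f.mapEdgeSet e)
    point_injective := D.point_injective.comp hf
    arc_continuous := fun e => D.arc_continuous _
    arc_injective := fun e => D.arc_injective _
    arc_ends := fun e => (D.arc_ends _).trans (Sym2.map_map ..)
    arc_ne_point := fun e t ht v => D.arc_ne_point _ t ht _
    arc_ne_arc := fun e f hef => D.arc_ne_arc _ _ (hinj.ne hef) }⟩

theorem IsPlanar.card_edgeSet_le {V : Type*} [Finite V] {G : SimpleGraph V} (h : IsPlanar G) :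
    Nat.card G.edgeSet ≤ 3 * Nat.card V := by
  have := Fintype.ofFinite V
  have := Fintype.ofFinite G.edgeSet
  obtain ⟨src, tgt, hends, F, _, ⟨D⟩⟩ := h.exists_dualGraph
  rw [Nat.card_eq_fintype_card, Nat.card_eq_fintype_card]
  refine D.card_edges_le (fun e he => ?_) fun e f hef => Subtype.ext ?_
  · have := G.not_isDiag_of_mem_edgeSet e.2
    rw [hends e, he] at this
    exact this rfl
  · rw [hends e, hends f, hef]

section Orientation
variable {V : Type*} {G : SimpleGraph V} {src tgt : G.edgeSet → V}

/-- A function that does not change along the edges of a connected spanning subgraph is constant. -/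
theorem SimpleGraph.Connected.apply_eq_of_forall_edge {T : SimpleGraph V} (hT : T.Connected)
    (hTG : T ≤ G) (hends : ∀ e : G.edgeSet, (e : Sym2 V) = s(src e, tgt e)) {α : Type*} {g : V → α}
    (hg : ∀ e : G.edgeSet, (e : Sym2 V) ∈ T.edgeSet → g (src e) = g (tgt e)) (u v : V) :
    g u = g v := by
  obtain ⟨p⟩ := hT.preconnected u v
  induction p with
  | nil => rfl
  | @cons a b c h p ih =>
    refine Eq.trans ?_ ih
    have h1 := hg ⟨s(a, b), hTG h⟩ h
    rcases Sym2.eq_iff.1 (hends ⟨s(a, b), hTG h⟩) with ⟨h2, h3⟩ | ⟨h2, h3⟩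
    · rwa [← h2, ← h3] at h1
    · rw [← h2, ← h3] at h1
      exact h1.symm

/-- A forest carries no nonzero cycle. -/
theorem SimpleGraph.IsAcyclic.eq_zero_of_mem_cyclesIn [Fintype G.edgeSet] {T : SimpleGraph V}
    (hT : T.IsAcyclic) (hends : ∀ e : G.edgeSet, (e : Sym2 V) = s(src e, tgt e))
    {z : G.edgeSet → ℚ} (hz : z ∈ cyclesIn src tgt {e | (e : Sym2 V) ∈ T.edgeSet}) : z = 0 := by
  by_contra hne
  obtain ⟨e, he⟩ := Function.ne_iff.1 hne
  have heT : (e : Sym2 V) ∈ T.edgeSet := by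
    by_contra h
    exact he ((mem_cyclesIn.1 hz).2 e h)
  have hjoin := joinedBy_of_mem_cyclesIn hz he
  have hbridge := isAcyclic_iff_forall_isBridge.1 hT heT
  rw [hends e, isBridge_iff] at hbridge
  refine hbridge (ConnectedComponent.exact (hjoin.apply_eq fun f hf => ConnectedComponent.sound ?_))
  refine Adj.reachable (deleteEdges_adj.2 ⟨?_, ?_⟩)
  · rw [← mem_edgeSet, ← hends f]
    exact hf.1
  · rw [Set.mem_singleton_iff, ← hends f, ← hends e]
    exact fun h => hf.2 (Subtype.ext h)

/-- The edges of a spanning tree can be distributed to their ends so that the root receives no edge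
and every other vertex receives one. -/
theorem exists_orientation_of_isTree [Finite V] [DecidableEq V] [Fintype G.edgeSet]
    {T : SimpleGraph V} (hT : T.IsTree)
    (hTG : T ≤ G) (hends : ∀ e : G.edgeSet, (e : Sym2 V) = s(src e, tgt e))
    (r : V) :
    ∃ p q : G.edgeSet → ℝ, (∀ e, 0 ≤ p e) ∧ (∀ e, 0 ≤ q e) ∧
      (∀ e, p e + q e = edgeVector G T e) ∧
      ∀ v, ∑ e, ((if src e = v then p e else 0) + (if tgt e = v then q e else 0)) =
        if v = r then 0 else 1 := by
  classical
  have := Fintype.ofFinite V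
  let J := edgesOf G T
  obtain ⟨p, q, hp, hq, hpq, hv⟩ := exists_tree_orientation (J := J) (fun e => src e)
      (fun e => tgt e) r
    (fun φ hφ h0 => funext fun v => by
      rw [hT.connected.apply_eq_of_forall_edge hTG hends (g := φ)
        (fun e he => hφ ⟨e, mem_edgesOf.2 he⟩) v r, h0]
      rfl)
    (by rw [Fintype.card_coe, edgesOf_card_of_isTree hT hTG, Nat.card_eq_fintype_card])
  refine ⟨fun e => if h : e ∈ J then p ⟨e, h⟩ else 0, fun e => if h : e ∈ J then q ⟨e, h⟩ else 0,
    fun e => ?_, fun e => ?_, fun e => ?_, fun v => ?_⟩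
  · dsimp only
    split_ifs
    exacts [hp _, le_rfl]
  · dsimp only
    split_ifs
    exacts [hq _, le_rfl]
  · rw [edgeVector_eq]
    dsimp only
    by_cases h : e ∈ J
    · rw [dif_pos h, dif_pos h, hpq, if_pos (mem_edgesOf.1 h)]
    · rw [dif_neg h, dif_neg h, add_zero, if_neg fun h' => h (mem_edgesOf.2 h')]
  · rw [← hv v]
    rw [← Finset.sum_subset (Finset.subset_univ J), ← Finset.sum_coe_sort]
    · refine Finset.sum_congr rfl fun e _ => ?_
      simp
    · intro e _ he
      simp [he]

end Orientation

theorem SimpleGraph.exists_ends {V : Type*} (G : SimpleGraph V) :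
    ∃ src tgt : G.edgeSet → V, ∀ e : G.edgeSet, (e : Sym2 V) = s(src e, tgt e) :=
  ⟨fun e => (e : Sym2 V).out.1, fun e => (e : Sym2 V).out.2, fun _ => (Quot.out_eq _).symm⟩

section Formulations
variable {V : Type*} [Finite V] {G : SimpleGraph V} [Fintype G.edgeSet]

/-- Martin's formulation for the sets that contain a given vertex: the edges are fractionally
oriented away from the vertex. -/
theorem exists_formulation_of_vertex (v : V) :
    ∃ R : Set (G.edgeSet → ℝ), HasExtendedFormulation R (2 * Fintype.card G.edgeSet) ∧
      (∀ T ≤ G, T.IsTree → edgeVector G T ∈ R) ∧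
      ∀ x ∈ R, ∀ U : Finset V, v ∈ U → ∑ e ∈ edgesWithin G U, x e ≤ (U.card : ℝ) - 1 := by
  classical
  have := Fintype.ofFinite V
  obtain ⟨src, tgt, hends⟩ := G.exists_ends
  let T : Fin 2 → G.edgeSet → ((G.edgeSet → ℝ) × (Fin 2 → G.edgeSet → ℝ)) →ₗ[ℝ] ℝ := fun i e =>
    LinearMap.proj e ∘ₗ LinearMap.proj i ∘ₗ LinearMap.snd ℝ _ _
  let X : G.edgeSet → ((G.edgeSet → ℝ) × (Fin 2 → G.edgeSet → ℝ)) →ₗ[ℝ] ℝ := fun e =>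
    LinearMap.proj e ∘ₗ LinearMap.fst ℝ _ _
  have hef := (((HasExtendedFormulation.forall_nonneg fun j : Fin 2 × G.edgeSet => T j.1 j.2).inter
    (HasExtendedFormulation.forall_eq (fun e => T 0 e + T 1 e - X e) 0)).inter
    (HasExtendedFormulation.forall_eq (fun w => ∑ e, ((if src e = w then T 0 e else 0) +
      (if tgt e = w then T 1 e else 0))) fun w => if w = v then 0 else 1)).proj
  refine ⟨_, by convert hef using 1; simp, ?_, ?_⟩
  · intro S hSG hS
    obtain ⟨p, q, hp, hq, hpq, hv⟩ := exists_orientation_of_isTree hS hSG hends v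
    refine ⟨![p, q], ⟨?_, ?_⟩, ?_⟩
    · rintro ⟨i, e⟩
      fin_cases i
      exacts [hp e, hq e]
    · intro e
      simp [T, X, hpq]
    · intro w
      rw [← hv w, LinearMap.sum_apply]
      refine Finset.sum_congr rfl fun e _ => ?_
      rw [LinearMap.add_apply]
      congr 1 <;> split_ifs <;> rfl
  · rintro x ⟨y, ⟨h1, h2⟩, h3⟩ U hU
    have hx : ∀ e, x e = y 0 e + y 1 e := fun e => (sub_eq_zero.1 (h2 e)).symm
    have hw : ∀ w, ∑ e, ((if src e = w then y 0 e else 0) + (if tgt e = w then y 1 e else 0)) =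
        if w = v then 0 else 1 := by
      intro w
      rw [← h3 w, LinearMap.sum_apply]
      refine Finset.sum_congr rfl fun e _ => ?_
      rw [LinearMap.add_apply]
      congr 1 <;> split_ifs <;> rfl
    have hy0 : ∀ e, 0 ≤ y 0 e := fun e => h1 (0, e)
    have hy1 : ∀ e, 0 ≤ y 1 e := fun e => h1 (1, e)
    calc ∑ e ∈ edgesWithin G U, x e
        = ∑ e ∈ edgesWithin G U, ∑ w ∈ U,
            ((if src e = w then y 0 e else 0) + (if tgt e = w then y 1 e else 0)) := by
          refine Finset.sum_congr rfl fun e he => ?_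
          rw [mem_edgesWithin, hends e] at he
          rw [Finset.sum_add_distrib, Finset.sum_ite_eq, Finset.sum_ite_eq,
            if_pos (he _ (by simp)), if_pos (he _ (by simp)), hx]
      _ ≤ ∑ e, ∑ w ∈ U, ((if src e = w then y 0 e else 0) + (if tgt e = w then y 1 e else 0)) := by
          refine Finset.sum_le_sum_of_subset_of_nonneg (Finset.subset_univ _) fun e _ _ =>
            Finset.sum_nonneg fun w _ => add_nonneg ?_ ?_
          · split_ifs
            exacts [hy0 e, le_rfl]
          · split_ifs
            exacts [hy1 e, le_rfl]
      _ = ∑ w ∈ U, (1 - if w = v then 1 else 0) := by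
          rw [Finset.sum_comm]
          refine Finset.sum_congr rfl fun w _ => ?_
          rw [hw w]
          split_ifs <;> norm_num
      _ = (U.card : ℝ) - 1 := by
          rw [Finset.sum_sub_distrib, Finset.sum_ite_eq', if_pos hU]
          simp

/-- Williams' formulation for a connected planar graph: the edges of a spanning tree are
fractionally oriented away from a root vertex, the remaining edges, in the dual graph, away from a
root face. The vector `x` is only required to lie below the fractional tree, so that the
characteristic vectors of forests are feasible too. -/
theorem IsPlanar.exists_formulation (hp : IsPlanar G) (hG : G.Connected) :
    ∃ R : Set (G.edgeSet → ℝ), HasExtendedFormulation R (5 * Fintype.card G.edgeSet) ∧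
      (∀ F ≤ G, F.IsAcyclic → edgeVector G F ∈ R) ∧
      ∀ x ∈ R, ∀ U : Finset V, U.Nonempty → ∑ e ∈ edgesWithin G U, x e ≤ (U.card : ℝ) - 1 := by
  classical
  have := Fintype.ofFinite V
  rcases isEmpty_or_nonempty G.edgeSet with hE | ⟨⟨e₀⟩⟩
  · refine ⟨Set.univ, by simpa using HasExtendedFormulation.univ, fun _ _ _ => Set.mem_univ _,
      fun x _ U hU => ?_⟩
    rw [Finset.eq_empty_of_isEmpty (edgesWithin G U), Finset.sum_empty, sub_nonneg]
    exact_mod_cast hU.card_pos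
  obtain ⟨src, tgt, hends, F, _, ⟨D⟩⟩ := hp.exists_dualGraph
  let T : Fin 4 → G.edgeSet → ((G.edgeSet → ℝ) × (Fin 4 → G.edgeSet → ℝ)) →ₗ[ℝ] ℝ := fun i e =>
    LinearMap.proj e ∘ₗ LinearMap.proj i ∘ₗ LinearMap.snd ℝ _ _
  let X : G.edgeSet → ((G.edgeSet → ℝ) × (Fin 4 → G.edgeSet → ℝ)) →ₗ[ℝ] ℝ := fun e =>
    LinearMap.proj e ∘ₗ LinearMap.fst ℝ _ _
  have hef := (((((HasExtendedFormulation.forall_nonneg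
      fun j : Fin 4 × G.edgeSet => T j.1 j.2).inter
    (HasExtendedFormulation.forall_nonneg fun e => T 0 e + T 1 e - X e)).inter
    (HasExtendedFormulation.forall_eq (fun e => T 0 e + T 1 e + T 2 e + T 3 e) 1)).inter
    (HasExtendedFormulation.forall_eq (fun w => ∑ e, ((if src e = w then T 0 e else 0) +
      (if tgt e = w then T 1 e else 0))) fun w => if w = src e₀ then 0 else 1)).inter
    (HasExtendedFormulation.forall_eq (fun f => ∑ e, ((if D.left e = f then T 2 e else 0) +
      (if D.right e = f then T 3 e else 0))) fun f => if f = D.left e₀ then 0 else 1)).proj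
  refine ⟨_, by convert hef using 1; simp; ring, ?_, ?_⟩
  · intro H hHG hH
    obtain ⟨S, hHS, hSG, hS⟩ := hG.exists_isTree_le_of_le_of_isAcyclic hHG hH
    obtain ⟨p, q, hp, hq, hpq, hv⟩ := exists_orientation_of_isTree hS hSG hends (src e₀)
    obtain ⟨p', q', hp', hq', hpq0, hpq1, hf⟩ := D.exists_cotree_orientation
      {e | (e : Sym2 V) ∈ S.edgeSet}
      (fun g hg => hS.connected.apply_eq_of_forall_edge hSG hends hg)
      (fun z hz => hS.isAcyclic.eq_zero_of_mem_cyclesIn hends hz) (D.left e₀)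
    refine ⟨![p, q, p', q'], ⟨⟨⟨?_, ?_⟩, ?_⟩, ?_⟩, ?_⟩
    · rintro ⟨i, e⟩
      fin_cases i
      exacts [hp e, hq e, hp' e, hq' e]
    · intro e
      suffices edgeVector G H e ≤ edgeVector G S e by simpa [T, X, hpq]
      rw [edgeVector_eq, edgeVector_eq]
      split_ifs with h1 h2
      · exact le_rfl
      · exact absurd (edgeSet_subset_edgeSet.2 hHS h1) h2
      · exact zero_le_one
      · exact le_rfl
    · intro e
      suffices p e + q e + p' e + q' e = 1 by simpa [T]
      rw [add_assoc, hpq, edgeVector_eq]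
      split_ifs with h
      · rw [hpq0 e h, add_zero]
      · rw [hpq1 e h, zero_add]
    · intro w
      rw [← hv w, LinearMap.sum_apply]
      refine Finset.sum_congr rfl fun e _ => ?_
      rw [LinearMap.add_apply]
      congr 1 <;> split_ifs <;> rfl
    · intro f
      rw [← hf f, LinearMap.sum_apply]
      refine Finset.sum_congr rfl fun e _ => ?_
      rw [LinearMap.add_apply]
      congr 1 <;> split_ifs <;> rfl
  · rintro x ⟨y, ⟨⟨⟨h1, h2⟩, h3⟩, h4⟩, h5⟩ U hU
    have hx : ∀ e, x e ≤ y 0 e + y 1 e := fun e => sub_nonneg.1 (h2 e)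
    have hset : edgesWithin G U = Finset.univ.filter fun e => src e ∈ U ∧ tgt e ∈ U := by
      ext e
      rw [mem_edgesWithin, hends e]
      simp
    refine (Finset.sum_le_sum fun e _ => hx e).trans ?_
    rw [hset]
    refine D.sum_inside_le (e₀ := e₀) (Or.inl rfl) (fun e => h1 (0, e)) (fun e => h1 (1, e))
      (fun e => h1 (2, e)) (fun e => h1 (3, e)) h3 (fun w => ?_) (fun f => ?_) U hU
    · rw [← h4 w, LinearMap.sum_apply]
      refine Finset.sum_congr rfl fun e _ => ?_
      rw [LinearMap.add_apply]
      congr 1 <;> split_ifs <;> rfl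
    · rw [← h5 f, LinearMap.sum_apply]
      refine Finset.sum_congr rfl fun e _ => ?_
      rw [LinearMap.add_apply]
      congr 1 <;> split_ifs <;> rfl

end Formulations

/-! ### Apex graphs -/

section Apex
variable {V : Type*} [Finite V] {G : SimpleGraph V} [Fintype G.edgeSet]

/-- The planar formulation, pulled back to a graph of which the planar graph is an induced
subgraph. -/
theorem IsPlanar.exists_formulation_of_embedding {W : Type*} {K : SimpleGraph W} [Fintype K.edgeSet]
    (hp : IsPlanar K) (hK : K.Connected) (f : K ↪g G) :
    ∃ R : Set (G.edgeSet → ℝ), HasExtendedFormulation R (5 * Fintype.card K.edgeSet) ∧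
      (∀ T : SimpleGraph V, T ≤ G → T.IsAcyclic → edgeVector G T ∈ R) ∧
      ∀ x ∈ R, ∀ U : Finset V, U.Nonempty → (∀ u ∈ U, u ∈ Set.range f) →
        ∑ e ∈ edgesWithin G U, x e ≤ (U.card : ℝ) - 1 := by
  classical
  have : Finite W := Finite.of_injective f f.injective
  have := Fintype.ofFinite W
  obtain ⟨R, hR, hT, hU⟩ := hp.exists_formulation hK
  refine ⟨_, hR.comap (LinearMap.funLeft ℝ ℝ f.mapEdgeSet), fun T hTG hTa => ?_,
    fun x hx U hne hUf => ?_⟩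
  · have h1 := hT (T.comap f) (fun a b h => f.map_adj_iff.1 (hTG h))
      (hTa.comap ⟨f, id⟩ f.injective)
    refine (congrArg (· ∈ R) (funext fun e => ?_)).mpr h1
    rw [LinearMap.funLeft_apply, edgeVector_eq, edgeVector_eq]
    obtain ⟨e, he⟩ := e
    induction e with | _ a b => rfl
  · have hcard : (Finset.univ.filter fun w => f w ∈ U).card = U.card := by
      rw [← Finset.card_map f.toEmbedding]
      congr 1
      ext u
      simp only [Finset.mem_map, Finset.mem_filter, Finset.mem_univ, true_and]
      constructor
      · rintro ⟨w, hw, rfl⟩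
        exact hw
      · intro hu
        obtain ⟨w, rfl⟩ := hUf u hu
        exact ⟨w, hu, rfl⟩
    have h1 := hU _ hx (Finset.univ.filter fun w => f w ∈ U)
      (by rw [← Finset.card_pos, hcard]; exact hne.card_pos)
    rw [hcard] at h1
    refine le_trans (le_of_eq ?_) h1
    have hmap : edgesWithin G U =
        (edgesWithin K (Finset.univ.filter fun w => f w ∈ U)).map f.mapEdgeSet := by
      ext ⟨e, he⟩
      induction e with | _ a b =>
      rw [Finset.mem_map, mem_edgesWithin]
      constructor
      · intro h
        obtain ⟨a, rfl⟩ := hUf a (h a (by simp))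
        obtain ⟨b, rfl⟩ := hUf b (h b (by simp))
        refine ⟨⟨s(a, b), f.map_adj_iff.1 he⟩, ?_, rfl⟩
        rw [mem_edgesWithin]
        simpa using h
      · rintro ⟨⟨e', he'⟩, h, h'⟩
        induction e' with | _ a' b' =>
        rw [mem_edgesWithin] at h
        have h2 : s(f a', f b') = s(a, b) := congrArg Subtype.val h'
        simp only [← h2]
        simpa using h
    rw [hmap, Finset.sum_map]
    rfl

omit [Finite V] in
theorem sum_card_edgeSet_components_le {s : Set V}
    [Fintype (G.induce s).ConnectedComponent]
    [∀ c : (G.induce s).ConnectedComponent, Fintype c.toSimpleGraph.edgeSet] :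
    ∑ c : (G.induce s).ConnectedComponent, Fintype.card c.toSimpleGraph.edgeSet ≤
      Fintype.card G.edgeSet := by
  rw [← Fintype.card_sigma]
  refine Fintype.card_le_of_injective
    (fun p => (⟨Sym2.map (fun w : p.1.supp => ((w : s) : V)) p.2.1, ?_⟩ : G.edgeSet)) ?_
  · obtain ⟨c, e, he⟩ := p
    induction e with | _ a b => exact he
  · rintro ⟨c, e, he⟩ ⟨c', e', he'⟩ h
    have h1 := congrArg Subtype.val h
    induction e with | _ a b =>
    induction e' with | _ a' b' =>
    have h2 : s(((a : s) : V), ((b : s) : V)) = s(((a' : s) : V), ((b' : s) : V)) := h1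
    obtain rfl : c = c' := by
      rcases Sym2.eq_iff.1 h2 with ⟨h3, -⟩ | ⟨h3, -⟩
      · exact a.2.symm.trans ((congrArg _ (Subtype.ext h3)).trans a'.2)
      · exact a.2.symm.trans ((congrArg _ (Subtype.ext h3)).trans b'.2)
    have h3 : s(a, b) = s(a', b') :=
      Sym2.map.injective (f := fun w : c.supp => ((w : s) : V))
        (Subtype.val_injective.comp Subtype.val_injective) h1
    congr

/-- The formulation of the spanning tree polytope: nonnegativity, the number of edges, Martin's
formulation at every apex vertex and the planar formulation of every component of the rest. -/
theorem exists_formulation_spanningTreePolytope (hG : G.Connected) (X : Finset V)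
    (hX : IsPlanar (G.induce {v | v ∉ X})) :
    ∃ m ≤ (6 + 2 * X.card) * Fintype.card G.edgeSet,
      HasExtendedFormulation (spanningTreePolytope G) m := by
  classical
  have := Fintype.ofFinite V
  have : Fintype (G.induce {v | v ∉ X}).ConnectedComponent := Fintype.ofFinite _
  have : ∀ c : (G.induce {v | v ∉ X}).ConnectedComponent, Fintype c.toSimpleGraph.edgeSet :=
    fun c => Fintype.ofFinite _
  let f : ∀ c : (G.induce {v | v ∉ X}).ConnectedComponent, c.toSimpleGraph ↪g G := fun c =>
    ⟨⟨fun w => w.1.1, Subtype.val_injective.comp Subtype.val_injective⟩, Iff.rfl⟩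
  choose M hM hMT hMU using fun v : V => exists_formulation_of_vertex (G := G) v
  choose R hR hRT hRU using fun c : (G.induce {v | v ∉ X}).ConnectedComponent =>
    (hX.of_injective (c.toSimpleGraph_hom) Subtype.val_injective).exists_formulation_of_embedding
      c.connected_toSimpleGraph (f c)
  have hef := (((HasExtendedFormulation.forall_nonneg
      fun e : G.edgeSet => LinearMap.proj (R := ℝ) (φ := fun _ => ℝ) e).inter
    (HasExtendedFormulation.eq (∑ e : G.edgeSet, LinearMap.proj (R := ℝ) (φ := fun _ => ℝ) e)
      ((Nat.card V : ℝ) - 1))).inter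
    (HasExtendedFormulation.biInter X fun v _ => hM v)).inter (HasExtendedFormulation.iInter hR)
  refine ⟨_, ?_, Eq.mp (congrArg (fun P => HasExtendedFormulation P _) ?_) hef⟩
  rotate_left
  · symm
    refine Set.Subset.antisymm (convexHull_min ?_ hef.convex) ?_
    · rintro _ ⟨T, hTG, hT, rfl⟩
      refine ⟨⟨⟨fun e => ?_, ?_⟩, fun v _ => hMT v T hTG hT⟩, fun c => hRT c T hTG hT.isAcyclic⟩
      · rw [LinearMap.proj_apply, edgeVector_eq]
        split_ifs <;> norm_num
      · rw [Set.mem_ofPred_eq, LinearMap.sum_apply]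
        simp only [LinearMap.proj_apply]
        rw [sum_edgeVector, Finset.univ_inter, ← edgesOf_card_of_isTree hT hTG]
        push_cast
        ring
    · rintro x ⟨⟨⟨h1, h2⟩, h3⟩, h4⟩
      rw [Set.mem_ofPred_eq, LinearMap.sum_apply] at h2
      refine mem_spanningTreePolytope hG h1 h2 fun U hU hconn => ?_
      -- a connected set `U` meets `X`, or it lies in one component of the rest
      by_cases hUX : ∃ v ∈ X, v ∈ U
      · obtain ⟨v, hvX, hvU⟩ := hUX
        exact hMU v x (h3 v hvX) U hvU
      · push Not at hUX
        have hsub : (U : Set V) ⊆ {v | v ∉ X} := fun v hv hvX => hUX v hvX hv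
        obtain ⟨u₀, hu₀⟩ := hU
        let c := (G.induce {v | v ∉ X}).connectedComponentMk ⟨u₀, hsub hu₀⟩
        refine hRU c x (h4 c) U ⟨u₀, hu₀⟩ fun u hu => ⟨⟨⟨u, hsub hu⟩, ?_⟩, rfl⟩
        exact ConnectedComponent.sound ((hconn.preconnected ⟨u, hu⟩ ⟨u₀, hu₀⟩).map
          (G.induceHomOfLE hsub).toHom)
  · have h1 := sum_card_edgeSet_components_le (G := G) (s := {v | v ∉ X})
    simp only [← Finset.mul_sum, Finset.sum_const, smul_eq_mul]
    linarith [Nat.mul_le_mul_left 5 h1]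

omit [Fintype G.edgeSet] in
/-- The edges at `X` number at most `|X| |V|`, the others at most `3 |V|`. -/
theorem card_edgeSet_le_of_isPlanar_induce (X : Finset V) (hX : IsPlanar (G.induce {v | v ∉ X})) :
    Nat.card G.edgeSet ≤ (3 + X.card) * Nat.card V := by
  classical
  have := Fintype.ofFinite V
  let H := G.induce {v | v ∉ X}
  have h1 : Nat.card H.edgeSet ≤ 3 * Nat.card V :=
    hX.card_edgeSet_le.trans (Nat.mul_le_mul_left 3 (Finite.card_subtype_le _))
  have hsub : G.edgeSet ⊆ Sym2.map Subtype.val '' H.edgeSet ∪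
      (fun p : V × V => s(p.1, p.2)) '' ((X : Set V) ×ˢ Set.univ) := by
    intro e he
    induction e with | _ a b =>
    by_cases ha : a ∈ X
    · exact Or.inr ⟨(a, b), ⟨ha, trivial⟩, rfl⟩
    by_cases hb : b ∈ X
    · exact Or.inr ⟨(b, a), ⟨hb, trivial⟩, Sym2.eq_swap⟩
    · exact Or.inl ⟨s(⟨a, ha⟩, ⟨b, hb⟩), he, rfl⟩
  rw [Nat.card_coe_set_eq]
  refine (Set.ncard_le_ncard hsub (Set.toFinite _)).trans ((Set.ncard_union_le _ _).trans ?_)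
  rw [add_mul]
  refine add_le_add ((Set.ncard_image_le (Set.toFinite _)).trans ?_)
    ((Set.ncard_image_le (Set.toFinite _)).trans ?_)
  · rwa [← Nat.card_coe_set_eq]
  · rw [Set.ncard_prod, Set.ncard_coe_finset, Set.ncard_univ]

end Apex

end Graphs

theorem theorem4 :
    ∃ C : ℕ, ∀ (V : Type*) [Finite V] (G : SimpleGraph V) (k : ℕ),
      1 ≤ k → G.Connected → IsApex k G →
        extensionComplexity (spanningTreePolytope G) ≤
            ((C * (k * Nat.card G.edgeSet) : ℕ) : ℕ∞) ∧
          k * Nat.card G.edgeSet ≤ C * (k ^ 2 * Nat.card V) ∧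
          extensionComplexity (spanningTreePolytope G) ≤
            ((C * (k ^ 2 * Nat.card V) : ℕ) : ℕ∞) := by
  refine ⟨32, fun V _ G k hk hG ⟨X, hXk, hX⟩ => ?_⟩
  have := Fintype.ofFinite G.edgeSet
  obtain ⟨m, hm, hef⟩ := exists_formulation_spanningTreePolytope hG X hX
  rw [← Nat.card_eq_fintype_card] at hm
  have hE : Nat.card G.edgeSet ≤ 4 * (k * Nat.card V) :=
    (card_edgeSet_le_of_isPlanar_induce X hX).trans
      ((Nat.mul_le_mul_right _ (by omega : 3 + X.card ≤ 4 * k)).trans (le_of_eq (mul_assoc _ _ _)))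
  have hm' : m ≤ 8 * (k * Nat.card G.edgeSet) :=
    hm.trans ((Nat.mul_le_mul_right _ (by omega : 6 + 2 * X.card ≤ 8 * k)).trans
      (le_of_eq (mul_assoc _ _ _)))
  have hkE : k * Nat.card G.edgeSet ≤ 4 * (k ^ 2 * Nat.card V) :=
    (Nat.mul_le_mul_left k hE).trans (le_of_eq (by ring))
  exact ⟨extensionComplexity_le hef (by omega), by omega, extensionComplexity_le hef (by omega)⟩
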